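/- Let $\mathbb D$ be the open unit disc with normalized area measure $dA$, let $A^2$ be the Bergman space of analytic functions in $L^2(\mathbb D,dA)$, and let $H^2$ be the Hardy space of analytic functions on $\mathbb D$ with square-summable Taylor coefficients. For $u\in L^\infty(\mathbb D)$ let $\tilde T_u:A^2\to A^2$, $\tilde T_u h=\tilde P(uh)$, be the Bergman Toeplitz operator, where $\tilde P$ is the orthogonal projection of $L^2(\mathbb D,dA)$ onto $A^2$. For an analytic function $b$ on $\mathbb D$ with $|b|\le 1$ on $\mathbb D$, let $\mathcal A(b)=(I-\tilde T_b\tilde T_{\bar b})^{1/2}A^2$ be the sub-Bergman space of $b$. Theorem. For every non-constant analytic function $b$ on $\mathbb D$ with $|b|\le 1$ on $\mathbb D$, one has $H^2\subseteq\mathcal A(b)$. Moreover, $\mathcal A(b)=H^2$ (as sets of functions on $\mathbb D$) if and only if $b$ is a finite Blaschke product, i.e. $b(z)=c\prod_{k=1}^n\frac{z-a_k}{1-\overline{a_k}z}$ for some $n\ge 0$, $|c|=1$ and $a_1,\dots,a_n\in\mathbb D$. -/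

import Mathlib

open MeasureTheory Metric Filter Topology
open scoped ENNReal ComplexConjugate

namespace SubBergman

/-- The open unit disc `𝔻`, as a type. -/
abbrev Disc : Type := ball (0 : ℂ) 1

/-- Normalized Lebesgue area measure `dA` on the unit disc. -/
noncomputable def area : Measure Disc := 
  ENNReal.ofReal Real.pi⁻¹ • Measure.comap ((↑) : Disc → ℂ) volume

/-- Analytic functions on the unit disc. -/
def IsAnalytic (f : Disc → ℂ) : Prop :=
  ∃ F : ℂ → ℂ, DifferentiableOn ℂ F (ball 0 1) ∧ ∀ z : Disc, f z = F z

/-- The closed unit ball `H^∞_1` of the space of bounded analytic functions on the disc. -/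
def unitBallHInfty : Set (Disc → ℂ) :=
  {b | IsAnalytic b ∧ ∀ z, ‖b z‖ ≤ 1}

/-- The Hardy space `H²`: analytic functions on the disc with square-summable Taylor
coefficients. -/
def hardySpace : Set (Disc → ℂ) :=
  {f | ∃ a : ℕ → ℂ, Summable (fun n => ‖a n‖ ^ 2) ∧
    ∀ z : Disc, HasSum (fun n => a n * (z : ℂ) ^ n) (f z)}

/-- Finite Blaschke products. -/
def IsFiniteBlaschkeProduct (b : Disc → ℂ) : Prop :=
  ∃ (n : ℕ) (a : Fin n → Disc) (c : ℂ), ‖c‖ = 1 ∧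
    ∀ z : Disc, b z = c * ∏ k, ((z : ℂ) - a k) / (1 - conj (a k : ℂ) * z)

lemma IsAnalytic.continuous {f : Disc → ℂ} (hf : IsAnalytic f) : Continuous f := by
  obtain ⟨F, hF, h⟩ := hf
  have : f = (ball (0 : ℂ) 1).domRestrict F := funext h
  rw [this]
  exact hF.continuousOn.domRestrict

lemma IsAnalytic.add {f g : Disc → ℂ} (hf : IsAnalytic f) (hg : IsAnalytic g) :
    IsAnalytic (f + g) := by
  obtain ⟨F, hF, h⟩ := hf
  obtain ⟨G, hG, h'⟩ := hg
  exact ⟨F + G, hF.add hG, fun z => by simp [h, h']⟩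

lemma IsAnalytic.const_smul {f : Disc → ℂ} (hf : IsAnalytic f) (c : ℂ) :
    IsAnalytic (c • f) := by
  obtain ⟨F, hF, h⟩ := hf
  exact ⟨c • F, hF.const_smul c, fun z => by simp [h]⟩

instance : IsFiniteMeasure area := by
  constructor
  rw [area, Measure.smul_apply, smul_eq_mul, comap_subtype_coe_apply measurableSet_ball,
    Set.image_univ, Subtype.range_coe]
  exact ENNReal.mul_lt_top ENNReal.ofReal_lt_top measure_ball_lt_top

/-- The Bergman space `A²`, as a subspace of `L²(𝔻, dA)`. -/
noncomputable def bergmanSpace : Submodule ℂ (Lp ℂ 2 area) where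
  carrier := {g | ∃ f : Disc → ℂ, IsAnalytic f ∧ g =ᵐ[area] f}
  zero_mem' := ⟨0, ⟨0, differentiableOn_const 0, fun _ => rfl⟩, Lp.coeFn_zero ℂ 2 area⟩
  add_mem' := by
    rintro g₁ g₂ ⟨f₁, h₁, e₁⟩ ⟨f₂, h₂, e₂⟩
    exact ⟨f₁ + f₂, h₁.add h₂, (Lp.coeFn_add g₁ g₂).trans (e₁.add e₂)⟩
  smul_mem' := by
    rintro c g ⟨f, h, e⟩
    exact ⟨c • f, h.const_smul c, (Lp.coeFn_smul c g).trans (e.const_smul c)⟩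

/-- Mean value inequality over a Euclidean disc. -/
lemma enorm_mul_volume_le {F : ℂ → ℂ} {z : ℂ} {r : ℝ} (hF : DifferentiableOn ℂ F (ball z r)) :
    ‖F z‖ₑ * volume (ball (0 : ℂ) r) ≤ ∫⁻ w in ball z r, ‖F w‖ₑ := by
  classical
  set g : ℂ → ℝ≥0∞ := (ball z r).indicator (fun w => ‖F w‖ₑ) with hg
  have hgm : Measurable g := by
    have h1 : Measurable ((ball z r).indicator F) := by
      rw [← Set.piecewise_eq_indicator]
      exact hF.continuousOn.measurable_piecewise continuousOn_const measurableSet_ball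
    have h2 : g = fun w => ‖(ball z r).indicator F w‖ₑ := by
      funext w
      by_cases hw : w ∈ ball z r <;> simp [hg, hw]
    rw [h2]
    exact h1.enorm
  have hgi : ∫⁻ w in ball z r, ‖F w‖ₑ = ∫⁻ w, g w := by
    rw [hg, lintegral_indicator measurableSet_ball]
  have hrot : ∀ θ : ℝ, ∫⁻ w, g (z + circleMap 0 1 θ * w) = ∫⁻ w, g w := by
    intro θ
    have h1 : ∀ w : ℂ, circleMap 0 1 θ * w = rotation (Circle.exp θ) w := by
      intro w; simp [circleMap, rotation_apply]
    simp_rw [h1]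
    rw [(rotation (Circle.exp θ)).measurePreserving.lintegral_comp
      (f := fun w => g (z + w)) (hgm.comp (measurable_const_add z))]
    exact lintegral_add_left_eq_self g z
  have hmean : ∀ w ∈ ball (0 : ℂ) r, ENNReal.ofReal (2 * Real.pi) * ‖F z‖ₑ ≤
      ∫⁻ θ in Set.Ioc 0 (2 * Real.pi), g (z + circleMap 0 1 θ * w) := by
    intro w hw
    rw [mem_ball_zero_iff] at hw
    have hmem : ∀ u ∈ closedBall (0 : ℂ) 1, z + u * w ∈ ball z r := by
      intro u hu
      rw [mem_closedBall_zero_iff] at hu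
      rw [mem_ball_iff_norm, add_sub_cancel_left, norm_mul]
      nlinarith [norm_nonneg w, norm_nonneg u]
    have hd : DifferentiableOn ℂ (fun u : ℂ => F (z + u * w)) (closedBall 0 1) :=
      hF.comp (by fun_prop) hmem
    have hdc : DiffContOnCl ℂ (fun u : ℂ => F (z + u * w)) (ball 0 |1|) := by
      apply DifferentiableOn.diffContOnCl
      rw [abs_one, closure_ball (0 : ℂ) one_ne_zero]
      exact hd
    have havg := hdc.circleAverage
    rw [Real.circleAverage_def] at havg
    simp only [zero_mul, add_zero] at havg
    have h2 : (2 * Real.pi : ℝ) • F z =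
        ∫ θ in Set.Ioc 0 (2 * Real.pi), F (z + circleMap 0 1 θ * w) := by
      rw [← havg, smul_smul, mul_inv_cancel₀ (by positivity), one_smul,
        intervalIntegral.integral_of_le (by positivity)]
    calc ENNReal.ofReal (2 * Real.pi) * ‖F z‖ₑ = ‖(2 * Real.pi : ℝ) • F z‖ₑ := by
          rw [enorm_smul, Real.enorm_eq_ofReal (by positivity)]
      _ ≤ ∫⁻ θ in Set.Ioc 0 (2 * Real.pi), ‖F (z + circleMap 0 1 θ * w)‖ₑ := by
          rw [h2]; exact enorm_integral_le_lintegral_enorm _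
      _ = _ := by
          refine lintegral_congr fun θ => ?_
          have : z + circleMap 0 1 θ * w ∈ ball z r := hmem _ (by simp)
          rw [hg, Set.indicator_of_mem this]
  have hpi : ENNReal.ofReal (2 * Real.pi) ≠ 0 := by
    simpa using Real.pi_pos
  rw [hgi, ← ENNReal.mul_le_mul_iff_right hpi ENNReal.ofReal_ne_top]
  calc ENNReal.ofReal (2 * Real.pi) * (‖F z‖ₑ * volume (ball (0 : ℂ) r))
      = ∫⁻ _ in ball (0 : ℂ) r, ENNReal.ofReal (2 * Real.pi) * ‖F z‖ₑ := by
        rw [setLIntegral_const, mul_assoc]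
    _ ≤ ∫⁻ w in ball (0 : ℂ) r,
          ∫⁻ θ in Set.Ioc 0 (2 * Real.pi), g (z + circleMap 0 1 θ * w) :=
        setLIntegral_mono' measurableSet_ball hmean
    _ ≤ ∫⁻ w, ∫⁻ θ in Set.Ioc 0 (2 * Real.pi), g (z + circleMap 0 1 θ * w) :=
        setLIntegral_le_lintegral _ _
    _ = ∫⁻ θ in Set.Ioc 0 (2 * Real.pi), ∫⁻ w, g (z + circleMap 0 1 θ * w) := by
        apply lintegral_lintegral_swap
        apply Measurable.aemeasurable
        apply hgm.comp
        have : Continuous (fun p : ℂ × ℝ => z + circleMap 0 1 p.2 * p.1) := by fun_prop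
        exact this.measurable
    _ = ENNReal.ofReal (2 * Real.pi) * ∫⁻ w, g w := by
        simp_rw [hrot]
        rw [setLIntegral_const, Real.volume_Ioc, sub_zero, mul_comm]

lemma lintegral_area (G : ℂ → ℝ≥0∞) :
    ∫⁻ z : Disc, G z ∂area = ENNReal.ofReal Real.pi⁻¹ * ∫⁻ w in ball (0 : ℂ) 1, G w := by
  rw [area, lintegral_smul_measure, smul_eq_mul, lintegral_subtype_comap measurableSet_ball]

/-- Point evaluations are bounded on `A²`, locally uniformly. -/
lemma exists_norm_le {ρ : ℝ} (hρ : ρ < 1) : ∃ C : ℝ, ∀ (F : ℂ → ℂ) (g : Lp ℂ 2 area),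
    DifferentiableOn ℂ F (ball 0 1) → (g =ᵐ[area] fun z => F z) →
    ∀ z ∈ closedBall (0 : ℂ) ρ, ‖F z‖ ≤ C * ‖g‖ := by
  set V : ℝ≥0∞ := volume (ball (0 : ℂ) (1 - ρ)) with hV
  have hV0 : V ≠ 0 := (measure_ball_pos volume _ (by linarith)).ne'
  have hVt : V ≠ ⊤ := measure_ball_lt_top.ne
  set D : ℝ≥0∞ := V⁻¹ * (ENNReal.ofReal Real.pi * area Set.univ ^ (1 / (1 : ℝ≥0∞).toReal -
    1 / (2 : ℝ≥0∞).toReal)) with hD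
  have hDt : D ≠ ⊤ := by
    refine ENNReal.mul_ne_top (ENNReal.inv_ne_top.2 hV0)
      (ENNReal.mul_ne_top ENNReal.ofReal_ne_top (ENNReal.rpow_ne_top_of_nonneg (by norm_num) ?_))
    exact measure_ne_top _ _
  refine ⟨D.toReal, fun F g hF hg z hz => ?_⟩
  have hsub : ball z (1 - ρ) ⊆ ball 0 1 := by
    apply ball_subset_ball'
    rw [mem_closedBall] at hz
    linarith
  have hpi : ENNReal.ofReal Real.pi * ENNReal.ofReal Real.pi⁻¹ = 1 := by
    rw [← ENNReal.ofReal_mul Real.pi_pos.le, mul_inv_cancel₀ Real.pi_ne_zero, ENNReal.ofReal_one]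
  have h1 : ‖F z‖ₑ * V ≤ ENNReal.ofReal Real.pi * (eLpNorm g 2 area * area Set.univ ^
      (1 / (1 : ℝ≥0∞).toReal - 1 / (2 : ℝ≥0∞).toReal)) := by
    calc ‖F z‖ₑ * V ≤ ∫⁻ w in ball z (1 - ρ), ‖F w‖ₑ := enorm_mul_volume_le (hF.mono hsub)
      _ ≤ ∫⁻ w in ball 0 1, ‖F w‖ₑ := lintegral_mono_set hsub
      _ = ENNReal.ofReal Real.pi * ∫⁻ w : Disc, ‖F w‖ₑ ∂area := by
          rw [lintegral_area (fun w => ‖F w‖ₑ), ← mul_assoc, hpi, one_mul]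
      _ = ENNReal.ofReal Real.pi * eLpNorm g 1 area := by
          rw [eLpNorm_congr_ae hg, eLpNorm_one_eq_lintegral_enorm]
      _ ≤ _ := by
          gcongr
          exact eLpNorm_le_eLpNorm_mul_rpow_measure_univ (by norm_num) (Lp.aestronglyMeasurable g)
  have h2 : ‖F z‖ₑ ≤ D * ‖g‖ₑ := by
    calc ‖F z‖ₑ = V⁻¹ * (‖F z‖ₑ * V) := by
          rw [mul_comm ‖F z‖ₑ, ← mul_assoc, ENNReal.inv_mul_cancel hV0 hVt, one_mul]
      _ ≤ V⁻¹ * _ := mul_le_mul' le_rfl h1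
      _ = D * ‖g‖ₑ := by rw [Lp.enorm_def, hD]; ring
  rw [← toReal_enorm, ← toReal_enorm g, ← ENNReal.toReal_mul]
  exact ENNReal.toReal_mono (ENNReal.mul_ne_top hDt enorm_ne_top) h2

lemma isClosed_bergmanSpace : IsClosed (bergmanSpace : Set (Lp ℂ 2 area)) := by
  rw [← isSeqClosed_iff_isClosed]
  intro g g₀ hg hlim
  choose f hf hgf using hg
  choose F hF hfF using hf
  have hgF : ∀ n, g n =ᵐ[area] fun z => F n z := fun n => by
    rw [← funext (hfF n)]; exact hgf n
  have hcau : CauchySeq g := hlim.cauchySeq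
  have key : ∀ ρ : ℝ, ρ < 1 → UniformCauchySeqOn F atTop (closedBall 0 ρ) := by
    intro ρ hρ
    obtain ⟨C, hC⟩ := exists_norm_le hρ
    rw [Metric.uniformCauchySeqOn_iff]
    intro ε hε
    obtain ⟨N, hN⟩ := Metric.cauchySeq_iff.1 hcau (ε / (|C| + 1)) (by positivity)
    refine ⟨N, fun m hm n hn z hz => ?_⟩
    have h1 := hC (F m - F n) (g m - g n) ((hF m).sub (hF n))
      ((Lp.coeFn_sub (g m) (g n)).trans ((hgF m).sub (hgF n))) z hz
    have h2 := hN m hm n hn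
    rw [dist_eq_norm] at h2 ⊢
    have h3 : (|C| + 1) * ‖g m - g n‖ < ε := by
      rwa [lt_div_iff₀' (by positivity)] at h2
    have h4 : C * ‖g m - g n‖ ≤ (|C| + 1) * ‖g m - g n‖ := by
      gcongr
      linarith [le_abs_self C]
    exact (h1.trans h4).trans_lt h3
  have hpt : ∀ z ∈ ball (0 : ℂ) 1, ∃ l, Tendsto (fun n => F n z) atTop (𝓝 l) := by
    intro z hz
    rw [mem_ball_zero_iff] at hz
    exact cauchySeq_tendsto_of_complete ((key ‖z‖ hz).cauchySeq (by simp))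
  choose! L hL using hpt
  have hLd : DifferentiableOn ℂ L (ball 0 1) := by
    refine TendstoLocallyUniformlyOn.differentiableOn (φ := atTop) (F := F) ?_
      (.of_forall hF) isOpen_ball
    rw [tendstoLocallyUniformlyOn_iff_forall_isCompact isOpen_ball]
    intro K hK hKc
    obtain ⟨ρ, hρ, hKρ⟩ : ∃ ρ < 1, K ⊆ closedBall (0 : ℂ) ρ := by
      obtain ⟨ρ, hρ, h⟩ := exists_lt_subset_ball hKc.isClosed hK
      exact ⟨ρ, hρ, h.trans ball_subset_closedBall⟩
    exact ((key ρ hρ).mono hKρ).tendstoUniformlyOn_of_tendsto fun z hz => hL z (hK hz)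
  obtain ⟨ns, hns, hae⟩ := (tendstoInMeasure_of_tendsto_Lp hlim).exists_seq_tendsto_ae
  refine ⟨fun z => L z, ⟨L, hLd, fun _ => rfl⟩, ?_⟩
  have hall : ∀ᵐ z ∂area, ∀ n, g n z = F n z := ae_all_iff.2 hgF
  filter_upwards [hae, hall] with z hz1 hz2
  refine tendsto_nhds_unique hz1 ?_
  simp_rw [hz2]
  exact (hL z z.2).comp hns.tendsto_atTop

instance : CompleteSpace bergmanSpace :=
  isClosed_bergmanSpace.completeSpace_coe

/-- The Bergman Toeplitz operator `T̃_u h = P̃(u h)` on `A²` with symbol `u ∈ L^∞(𝔻)`, where `P̃` is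
the orthogonal projection of `L²(𝔻, dA)` onto `A²`. -/
noncomputable def toeplitz (u : Lp ℂ ∞ area) : bergmanSpace →L[ℂ] bergmanSpace :=
  bergmanSpace.orthogonalProjectionOnto ∘L
    (ContinuousLinearMap.mul ℂ ℂ).holderL area ∞ 2 2 u ∘L bergmanSpace.subtypeL

/-- The positive square root `A^{1/2}` of a positive operator on a complex Hilbert space. -/
noncomputable def sqrtOp {H : Type*} [NormedAddCommGroup H] [InnerProductSpace ℂ H]
    [CompleteSpace H] (A : H →L[ℂ] H) : H →L[ℂ] H :=
  CFC.sqrt A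

/-- The sub-Bergman space `𝒜(u)`, i.e. the range of `(I - T̃_u T̃_ū)^{1/2}` on `A²`, as a set of
analytic functions on the disc. -/
noncomputable def subBergmanSpace (u : Lp ℂ ∞ area) : Set (Disc → ℂ) :=
  {f | IsAnalytic f ∧ ∃ h : bergmanSpace,
    f =ᵐ[area] (sqrtOp (1 - toeplitz u ∘L toeplitz (star u)) h : bergmanSpace).1}

lemma memLp_of_mem_unitBallHInfty {b : Disc → ℂ} (hb : b ∈ unitBallHInfty) : MemLp b ∞ area :=
  memLp_top_of_bound hb.1.continuous.aestronglyMeasurable 1 (.of_forall hb.2)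

end SubBergman

namespace SubBergman

/-! Write `S` for the Bergman shift, `M_b` for multiplication by `b` on `A²`, `α_b(g) = ‖g‖² -
‖M_b^* g‖²` and `Q(g) = ∑ₙ |⟨zⁿ, g⟩|²` (`hardyForm`). Since `‖zⁿ‖² = 1/(n+1)`, one finds `Q(g) =
‖g‖² - ‖S^* g‖²`, and `H²` consists of the `f` whose pairing with `g` is controlled by `Q(g)^{1/2}`.
Likewise `𝒜(b)` is governed by `α_b(g) = ‖R g‖²`, where `R` is the defect root. Inclusions between
the two spaces thus become comparisons of `Q` and `α_b`, in the spirit of Douglas' lemma.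

`H² ⊆ 𝒜(b)`: multiplication by `b` contracts the Hardy norm, so dually `Q(M_b^* g) ≤ Q(g)`, that is,
`α_b(g) - α_b(S^* g) ≥ 0`. Cauchy–Schwarz for this positive form against the vector `1`, which `S^*`
kills, and telescoping along `S^{*n} g` give `Q(M_k^* g) ≤ α_b(g)` with `k = 1 - conj(b(0)) b`. As
`|b(0)| < 1`, `k` is invertible in `H^∞`, so `Q ≤ K² α_b` (`exists_hardyForm_le`).

Finite Blaschke products: `α_b ≤ K Q` holds for one Möbius factor by an explicit identity and passes
to products (`IsDefectBounded.mul`), whence `𝒜(b) ⊆ H²` (`subBergmanSpace_subset`).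

Conversely, if `𝒜(b) ⊆ H²`, the growth of `H²` functions and uniform boundedness, tested on Bergman
kernels, give `1 - |b|² ≤ C (1 - |z|²)` (`exists_one_sub_norm_sq_le`). Hence `|b| → 1` at the
circle, and dividing out the zeros leaves a unimodular constant
(`isFiniteBlaschkeProduct_of_tendsto`). -/

/-! ### Analytic representatives, point evaluations and analytic Toeplitz operators. -/

/-- Bounded analytic functions on the disc. -/
def IsBoundedAnalytic (b : Disc → ℂ) : Prop :=
  IsAnalytic b ∧ ∃ C : ℝ, ∀ z, ‖b z‖ ≤ C

lemma IsAnalytic.mul {f g : Disc → ℂ} (hf : IsAnalytic f) (hg : IsAnalytic g) :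
    IsAnalytic (f * g) := by
  obtain ⟨F, hF, h⟩ := hf
  obtain ⟨G, hG, h'⟩ := hg
  exact ⟨F * G, hF.mul hG, fun z => by simp [h, h']⟩

lemma IsBoundedAnalytic.mul {f g : Disc → ℂ} (hf : IsBoundedAnalytic f)
    (hg : IsBoundedAnalytic g) : IsBoundedAnalytic (f * g) := by
  obtain ⟨hf, C, hC⟩ := hf
  obtain ⟨hg, D, hD⟩ := hg
  refine ⟨hf.mul hg, C * D, fun z => ?_⟩
  rw [Pi.mul_apply, norm_mul]
  exact mul_le_mul (hC z) (hD z) (norm_nonneg _) ((norm_nonneg _).trans (hC z))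

lemma IsBoundedAnalytic.memLp {b : Disc → ℂ} (hb : IsBoundedAnalytic b) : MemLp b ∞ area :=
  let ⟨C, hC⟩ := hb.2
  memLp_top_of_bound hb.1.continuous.aestronglyMeasurable C (.of_forall hC)

lemma isBoundedAnalytic_of_mem {b : Disc → ℂ} (hb : b ∈ unitBallHInfty) : IsBoundedAnalytic b :=
  ⟨hb.1, 1, hb.2⟩

/-- Analytic functions on the disc that agree almost everywhere agree everywhere. -/
lemma IsAnalytic.eq_of_ae_eq {f₁ f₂ : Disc → ℂ} (h₁ : IsAnalytic f₁) (h₂ : IsAnalytic f₂)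
    (h : f₁ =ᵐ[area] f₂) : f₁ = f₂ := by
  obtain ⟨F₁, d₁, e₁⟩ := h₁
  obtain ⟨F₂, d₂, e₂⟩ := h₂
  funext z
  have hz : ‖(z : ℂ)‖ < 1 := mem_ball_zero_iff.1 z.2
  obtain ⟨C, hC⟩ := exists_norm_le hz
  -- The difference represents `0` in `L²`, so the point evaluation bound with `‖g‖ = 0` makes it
  -- vanish at `z`.
  have h0 : (0 : Lp ℂ 2 area) =ᵐ[area] fun z : Disc => (F₁ - F₂) z := by
    filter_upwards [h, Lp.coeFn_zero ℂ 2 area] with w hw h0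
    rw [h0, Pi.sub_apply, ← e₁, ← e₂, hw, sub_self, Pi.zero_apply]
  have := hC (F₁ - F₂) 0 (d₁.sub d₂) h0 z (by simp)
  rw [norm_zero, mul_zero, norm_le_zero_iff, Pi.sub_apply, sub_eq_zero] at this
  rw [e₁, e₂, this]

/-- The analytic representative of an element of the Bergman space. -/
noncomputable def rep (g : bergmanSpace) : Disc → ℂ := g.2.choose

lemma isAnalytic_rep (g : bergmanSpace) : IsAnalytic (rep g) := g.2.choose_spec.1

lemma ae_eq_rep (g : bergmanSpace) : g.1 =ᵐ[area] rep g := g.2.choose_spec.2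

lemma rep_eq {g : bergmanSpace} {f : Disc → ℂ} (hf : IsAnalytic f) (h : g.1 =ᵐ[area] f) :
    rep g = f :=
  (isAnalytic_rep g).eq_of_ae_eq hf ((ae_eq_rep g).symm.trans h)

lemma rep_injective : Function.Injective rep := fun f g h =>
  Subtype.ext (Lp.ext ((ae_eq_rep f).trans (h ▸ (ae_eq_rep g).symm)))

lemma rep_add (f g : bergmanSpace) : rep (f + g) = rep f + rep g :=
  rep_eq ((isAnalytic_rep f).add (isAnalytic_rep g))
    ((Lp.coeFn_add f.1 g.1).trans ((ae_eq_rep f).add (ae_eq_rep g)))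

lemma rep_smul (c : ℂ) (f : bergmanSpace) : rep (c • f) = c • rep f :=
  rep_eq ((isAnalytic_rep f).const_smul c)
    ((Lp.coeFn_smul c f.1).trans ((ae_eq_rep f).const_smul c))

/-- Evaluation at a point of the disc, as a bounded functional on the Bergman space. -/
noncomputable def ev (z : Disc) : bergmanSpace →L[ℂ] ℂ :=
  LinearMap.mkContinuousOfExistsBound
    { toFun := fun g => rep g z
      map_add' := fun f g => by rw [rep_add, Pi.add_apply]
      map_smul' := fun c f => by rw [rep_smul, Pi.smul_apply, RingHom.id_apply] } <| by
    have hz : ‖(z : ℂ)‖ < 1 := mem_ball_zero_iff.1 z.2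
    obtain ⟨C, hC⟩ := exists_norm_le hz
    refine ⟨C, fun g => ?_⟩
    obtain ⟨G, hG, e⟩ := isAnalytic_rep g
    have := hC G g.1 hG ((ae_eq_rep g).trans (.of_forall e)) z (by simp)
    rwa [← e] at this

lemma ext_rep {f g : bergmanSpace} (h : ∀ z, rep f z = rep g z) : f = g :=
  rep_injective (funext h)

/-- Bounded analytic functions as elements of the Bergman space. -/
noncomputable def ofBounded (b : Disc → ℂ) (hb : IsBoundedAnalytic b) : bergmanSpace :=
  ⟨(hb.memLp.mono_exponent le_top).toLp b, b, hb.1,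
    (hb.memLp.mono_exponent le_top).coeFn_toLp⟩

@[simp] lemma rep_ofBounded (b : Disc → ℂ) (hb : IsBoundedAnalytic b) :
    rep (ofBounded b hb) = b :=
  rep_eq hb.1 (hb.memLp.mono_exponent le_top).coeFn_toLp

/-- Multiplication by a bounded analytic function, as an analytic Toeplitz operator. -/
noncomputable def mulOp (b : Disc → ℂ) (hb : IsBoundedAnalytic b) :
    bergmanSpace →L[ℂ] bergmanSpace :=
  toeplitz (hb.memLp.toLp b)

lemma inner_toeplitz_left (u : Lp ℂ ∞ area) (f g : bergmanSpace) :
    inner ℂ (toeplitz u f) g =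
      inner ℂ ((ContinuousLinearMap.mul ℂ ℂ).holderL area ∞ 2 2 u f.1) g.1 := by
  simp [toeplitz]

lemma inner_toeplitz_right (u : Lp ℂ ∞ area) (f g : bergmanSpace) :
    inner ℂ f (toeplitz u g) =
      inner ℂ f.1 ((ContinuousLinearMap.mul ℂ ℂ).holderL area ∞ 2 2 u g.1) := by
  simp [toeplitz]

lemma coeFn_holderL (u : Lp ℂ ∞ area) (f : Lp ℂ 2 area) :
    (ContinuousLinearMap.mul ℂ ℂ).holderL area ∞ 2 2 u f =ᵐ[area] fun z => u z * f z := by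
  filter_upwards [(ContinuousLinearMap.mul ℂ ℂ).coeFn_holder (r := 2) u f] with z hz
  simpa using hz

lemma toeplitz_star (u : Lp ℂ ∞ area) :
    toeplitz (star u) = ContinuousLinearMap.adjoint (toeplitz u) := by
  rw [ContinuousLinearMap.eq_adjoint_iff]
  intro f g
  rw [inner_toeplitz_left, inner_toeplitz_right, L2.inner_def, L2.inner_def]
  refine integral_congr_ae ?_
  filter_upwards [coeFn_holderL (star u) f.1, coeFn_holderL u g.1, Lp.coeFn_star u]
    with z h1 h2 h3
  rw [h1, h2, h3]
  simp
  ring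

/-- The product with an analytic symbol already lies in `bergmanSpace`, so the projection in
`toeplitz` does nothing. -/
lemma rep_mulOp (b : Disc → ℂ) (hb : IsBoundedAnalytic b) (g : bergmanSpace) :
    rep (mulOp b hb g) = b * rep g := by
  refine rep_eq (hb.1.mul (isAnalytic_rep g)) ?_
  have h : (ContinuousLinearMap.mul ℂ ℂ).holderL area ∞ 2 2 (hb.memLp.toLp b) g.1 =ᵐ[area]
      b * rep g := by
    filter_upwards [coeFn_holderL (hb.memLp.toLp b) g.1, MemLp.coeFn_toLp hb.memLp, ae_eq_rep g]
      with z h1 h2 h3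
    rw [h1, h2, h3, Pi.mul_apply]
  have hm : (ContinuousLinearMap.mul ℂ ℂ).holderL area ∞ 2 2 (hb.memLp.toLp b) g.1 ∈
      bergmanSpace := ⟨_, hb.1.mul (isAnalytic_rep g), h⟩
  have : (mulOp b hb g).1 =
      (ContinuousLinearMap.mul ℂ ℂ).holderL area ∞ 2 2 (hb.memLp.toLp b) g.1 := by
    have := bergmanSpace.starProjection_eq_self_iff.2 hm
    simpa [mulOp, toeplitz] using this
  rwa [this]

lemma mulOp_mul {b c : Disc → ℂ} (hb : IsBoundedAnalytic b) (hc : IsBoundedAnalytic c)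
    (g : bergmanSpace) : mulOp (b * c) (hb.mul hc) g = mulOp b hb (mulOp c hc g) :=
  ext_rep fun z => by simp [rep_mulOp, mul_assoc]

/-! ### Power series integrated over rotation-invariant sets. -/

/-- A set of complex numbers that is invariant under rotations about the origin. -/
def IsRadial (s : Set ℂ) : Prop := ∀ (u : Circle) (z : ℂ), (u : ℂ) * z ∈ s ↔ z ∈ s

lemma isRadial_ball (r : ℝ) : IsRadial (ball 0 r) := fun u z => by simp [Circle.norm_coe]

lemma isRadial_annulus (r R : ℝ) : IsRadial (ball 0 R \ ball 0 r) :=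
  fun u z => by simp [Circle.norm_coe]

lemma integrableOn_of_bounded {s : Set ℂ} {r : ℝ} (hs : MeasurableSet s) (hr : s ⊆ ball 0 r)
    {f : ℂ → ℂ} (hf : AEStronglyMeasurable f (volume.restrict s)) {C : ℝ}
    (hC : ∀ z ∈ s, ‖f z‖ ≤ C) : IntegrableOn f s :=
  IntegrableOn.of_bound ((measure_mono hr).trans_lt measure_ball_lt_top) hf C
    ((ae_restrict_iff' hs).2 (.of_forall hC))

lemma setIntegral_conj_pow_mul_pow_of_ne {s : Set ℂ} (hrad : IsRadial s) {n m : ℕ} (h : n ≠ m) :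
    ∫ z in s, conj (z ^ n) * z ^ m = 0 := by
  -- Rotation by this angle preserves `s` and multiplies the integrand by `exp(i(m - n)θ) = -1`, so
  -- the integral equals its own negative.
  set θ : ℝ := Real.pi / ((m : ℝ) - n) with hθ
  set u := Circle.exp θ with hu
  have hmn : (m : ℝ) - n ≠ 0 := sub_ne_zero.2 (by exact_mod_cast h.symm)
  have hmn' : (m : ℂ) - n ≠ 0 := by exact_mod_cast hmn
  have hu1 : conj ((u : ℂ) ^ n) * (u : ℂ) ^ m = -1 := by
    rw [hu, Circle.coe_exp, ← Complex.exp_nat_mul, ← Complex.exp_conj, ← Complex.exp_nat_mul,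
      ← Complex.exp_add, ← Complex.exp_pi_mul_I]
    congr 1
    simp only [map_mul, map_natCast, Complex.conj_ofReal, Complex.conj_I, hθ]
    push_cast
    field_simp
    ring
  have hpre : (rotation u) ⁻¹' s = s := by
    ext z
    simpa [rotation_apply] using hrad u z
  have hinv := (rotation u).measurePreserving.setIntegral_preimage_emb
    (rotation u).toHomeomorph.measurableEmbedding (fun z => conj (z ^ n) * z ^ m) s
  rw [hpre] at hinv
  have h2 : ∀ z, conj ((rotation u z) ^ n) * (rotation u z) ^ m = -(conj (z ^ n) * z ^ m) := by
    intro z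
    rw [rotation_apply, mul_pow, mul_pow, map_mul]
    linear_combination (conj (z ^ n) * z ^ m) * hu1
  simp_rw [h2, integral_neg] at hinv
  linear_combination (-1/2 : ℂ) * hinv

lemma conj_pow_mul_pow_self (n : ℕ) (z : ℂ) : conj (z ^ n) * z ^ n = ((‖z‖ ^ (2 * n) : ℝ) : ℂ) := by
  rw [Complex.conj_mul', norm_pow, pow_mul', Complex.ofReal_pow (_ ^ n)]

/-- Termwise integration of a power series over a radial set. -/
lemma hasSum_setIntegral {s : Set ℂ} {r : ℝ} (hs : MeasurableSet s) (hr0 : 0 ≤ r) (hr1 : r < 1)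
    (hr : s ⊆ ball 0 r) {a : ℕ → ℂ} {F : ℂ → ℂ}
    (hF : ∀ z ∈ ball (0 : ℂ) 1, HasSum (fun n => a n * z ^ n) (F z))
    {w : ℂ → ℂ} (hw : AEStronglyMeasurable w (volume.restrict s)) {C : ℝ}
    (hC : ∀ z ∈ s, ‖w z‖ ≤ C) :
    HasSum (fun n => a n * ∫ z in s, w z * z ^ n) (∫ z in s, w z * F z) := by
  have hfin : volume s < ⊤ := (measure_mono hr).trans_lt measure_ball_lt_top
  have hbd : ∀ n, ∀ z ∈ s, ‖w z * (a n * z ^ n)‖ ≤ C * (‖a n‖ * r ^ n) := by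
    intro n z hz
    have hz' : ‖z‖ ≤ r := (mem_ball_zero_iff.1 (hr hz)).le
    rw [norm_mul, norm_mul, norm_pow]
    gcongr
    · exact (norm_nonneg _).trans (hC z hz)
    · exact hC z hz
  have hmeas : ∀ n, AEStronglyMeasurable (fun z => w z * (a n * z ^ n)) (volume.restrict s) :=
    fun n => hw.mul (by fun_prop)
  have hsum : Summable fun n => ‖a n‖ * r ^ n := by
    have := (hF r (by simp [abs_of_nonneg hr0, hr1])).summable.norm
    simpa [abs_of_nonneg hr0] using this
  have key := hasSum_integral_of_summable_integral_norm (μ := volume.restrict s)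
    (F := fun n z => w z * (a n * z ^ n))
    (fun n => integrableOn_of_bounded hs hr (hmeas n) (hbd n)) (by
      refine .of_nonneg_of_le (fun n => integral_nonneg fun z => norm_nonneg _) (fun n => ?_)
        ((hsum.mul_left C).mul_right (volume.real s))
      refine (le_abs_self _).trans ?_
      rw [← Real.norm_eq_abs]
      refine norm_setIntegral_le_of_norm_le_const hfin fun z hz => ?_
      rw [norm_norm]
      exact hbd n z hz)
  have h1 : ∫ z in s, w z * F z = ∫ z in s, ∑' n, w z * (a n * z ^ n) :=
    setIntegral_congr_fun hs fun z hz =>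
      ((hF z (ball_subset_ball hr1.le (hr hz))).mul_left (w z)).tsum_eq.symm
  rw [h1]
  refine key.congr_fun fun n => ?_
  rw [← integral_const_mul]
  congr 1
  funext z
  ring

lemma setIntegral_conj_pow_mul {s : Set ℂ} {r : ℝ} (hs : MeasurableSet s) (hrad : IsRadial s)
    (hr0 : 0 ≤ r) (hr1 : r < 1) (hr : s ⊆ ball 0 r) {a : ℕ → ℂ} {F : ℂ → ℂ}
    (hF : ∀ z ∈ ball (0 : ℂ) 1, HasSum (fun n => a n * z ^ n) (F z)) (n : ℕ) :
    ∫ z in s, conj (z ^ n) * F z = a n * ∫ z in s, ((‖z‖ ^ (2 * n) : ℝ) : ℂ) := by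
  have h := hasSum_setIntegral hs hr0 hr1 hr hF (w := fun z => conj (z ^ n)) (C := 1)
    (by fun_prop) (fun z hz => by
      rw [RCLike.norm_conj, norm_pow]
      exact pow_le_one₀ (norm_nonneg _) ((mem_ball_zero_iff.1 (hr hz)).le.trans hr1.le))
  refine h.unique ?_
  simp_rw [← conj_pow_mul_pow_self]
  refine hasSum_single n fun m hm => ?_
  rw [setIntegral_conj_pow_mul_pow_of_ne hrad hm.symm, mul_zero]

/-- Parseval's identity over a radial set. -/
lemma hasSum_setIntegral_normSq {s : Set ℂ} {r : ℝ} (hs : MeasurableSet s) (hrad : IsRadial s)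
    (hr0 : 0 ≤ r) (hr1 : r < 1) (hr : s ⊆ ball 0 r) {a : ℕ → ℂ} {F : ℂ → ℂ}
    (hd : DifferentiableOn ℂ F (ball 0 1))
    (hF : ∀ z ∈ ball (0 : ℂ) 1, HasSum (fun n => a n * z ^ n) (F z)) :
    HasSum (fun n => ‖a n‖ ^ 2 * ∫ z in s, ‖z‖ ^ (2 * n)) (∫ z in s, ‖F z‖ ^ 2) := by
  have hcont : ContinuousOn F (closedBall 0 r) :=
    hd.continuousOn.mono (closedBall_subset_ball hr1)
  obtain ⟨C, hC⟩ := (isCompact_closedBall (0 : ℂ) r).exists_bound_of_continuousOn hcont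
  have hmF : AEStronglyMeasurable F (volume.restrict s) :=
    (hcont.aestronglyMeasurable measurableSet_closedBall).mono_measure
      (Measure.restrict_mono (hr.trans ball_subset_closedBall) le_rfl)
  have h := hasSum_setIntegral hs hr0 hr1 hr hF (w := fun z => conj (F z)) (C := C)
    (Complex.continuous_conj.comp_aestronglyMeasurable hmF) (fun z hz => by
      rw [RCLike.norm_conj]
      exact hC z (ball_subset_closedBall (hr hz)))
  have h2 : ∀ n, a n * ∫ z in s, conj (F z) * z ^ n =
      ((‖a n‖ ^ 2 * ∫ z in s, ‖z‖ ^ (2 * n) : ℝ) : ℂ) := by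
    intro n
    have h3 : ∫ z in s, conj (F z) * z ^ n = conj (∫ z in s, conj (z ^ n) * F z) := by
      rw [← integral_conj]
      congr 1
      funext z
      rw [map_mul, Complex.conj_conj, mul_comm]
    rw [h3, setIntegral_conj_pow_mul hs hrad hr0 hr1 hr hF, integral_complex_ofReal, map_mul,
      Complex.conj_ofReal, ← mul_assoc, Complex.mul_conj']
    push_cast
    rfl
  have h4 : ∫ z in s, conj (F z) * F z = ((∫ z in s, ‖F z‖ ^ 2 : ℝ) : ℂ) := by
    rw [← integral_complex_ofReal]
    congr 1
    funext z
    rw [Complex.conj_mul']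
    push_cast
    rfl
  simp_rw [h2, h4] at h
  exact Complex.hasSum_ofReal.1 h

lemma setIntegral_ball_norm_pow {r : ℝ} (hr : 0 ≤ r) (n : ℕ) :
    ∫ z in ball (0 : ℂ) r, ‖z‖ ^ (2 * n) = Real.pi * r ^ (2 * n + 2) / (n + 1) := by
  have h := integral_fun_norm_addHaar (volume : Measure ℂ)
    ((Set.Iio r).indicator fun y : ℝ => y ^ (2 * n))
  have h1 : ∀ z : ℂ, (Set.Iio r).indicator (fun y : ℝ => y ^ (2 * n)) ‖z‖ =
      (ball (0 : ℂ) r).indicator (fun z => ‖z‖ ^ (2 * n)) z := fun z => by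
    by_cases hz : ‖z‖ < r
    · rw [Set.indicator_of_mem (by exact hz), Set.indicator_of_mem (mem_ball_zero_iff.2 hz)]
    · rw [Set.indicator_of_notMem (by exact hz),
        Set.indicator_of_notMem (by rwa [mem_ball_zero_iff])]
  simp_rw [h1] at h
  rw [integral_indicator measurableSet_ball, Complex.finrank_real_complex] at h
  have h2 : ∀ y : ℝ, y ^ (2 - 1) • (Set.Iio r).indicator (fun y : ℝ => y ^ (2 * n)) y =
      (Set.Iio r).indicator (fun y : ℝ => y ^ (2 * n + 1)) y := fun y => by
    by_cases hy : y < r <;> simp [hy, pow_succ, mul_comm]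
  simp_rw [h2] at h
  rw [h, setIntegral_indicator measurableSet_Iio, Set.Ioi_inter_Iio,
    ← integral_Ioc_eq_integral_Ioo, ← intervalIntegral.integral_of_le hr, integral_pow]
  have hv : (volume : Measure ℂ).real (ball 0 1) = Real.pi := by
    simp [Measure.real, Complex.volume_ball]
  rw [hv]
  have : (n : ℝ) + 1 ≠ 0 := by positivity
  simp
  field_simp
  ring

/-! ### Monomials, Taylor coefficients and the orthonormal basis of `A²`. -/

lemma exists_hasSum_of_differentiableOn {F : ℂ → ℂ} (hF : DifferentiableOn ℂ F (ball 0 1)) :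
    ∃ a : ℕ → ℂ, ∀ z ∈ ball (0 : ℂ) 1, HasSum (fun n => a n * z ^ n) (F z) := by
  refine ⟨fun n => (n.factorial : ℂ)⁻¹ * iteratedDeriv n F 0, fun z hz => ?_⟩
  refine (Complex.hasSum_taylorSeries_on_ball hF hz).congr_fun fun n => ?_
  simp only [sub_zero, smul_eq_mul]
  ring

lemma integral_area (G : ℂ → ℂ) :
    ∫ z : Disc, G z ∂area = (Real.pi : ℂ)⁻¹ * ∫ w in ball (0 : ℂ) 1, G w := by
  rw [area, integral_smul_measure, integral_subtype_comap measurableSet_ball,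
    ENNReal.toReal_ofReal (by positivity), Complex.real_smul]
  push_cast
  rfl

lemma integrableOn_of_integrable_area {G : ℂ → ℂ} (h : Integrable (fun z : Disc => G z) area) :
    IntegrableOn G (ball 0 1) := by
  rw [area, integrable_smul_measure (by simpa using Real.pi_pos) ENNReal.ofReal_ne_top] at h
  exact ((MeasurableEmbedding.subtype_coe measurableSet_ball).integrableOn_range_iff_comap.2
    h).mono_set (by rw [Subtype.range_coe])

lemma isBoundedAnalytic_pow (n : ℕ) : IsBoundedAnalytic fun z : Disc => (z : ℂ) ^ n :=
  ⟨⟨fun z => z ^ n, by fun_prop, fun _ => rfl⟩, 1, fun z => by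
    rw [norm_pow]
    exact pow_le_one₀ (norm_nonneg _) (mem_ball_zero_iff.1 z.2).le⟩

/-- The monomial `z ^ n` in the Bergman space. -/
noncomputable def mono (n : ℕ) : bergmanSpace := ofBounded _ (isBoundedAnalytic_pow n)

@[simp] lemma rep_mono (n : ℕ) (z : Disc) : rep (mono n) z = (z : ℂ) ^ n :=
  congrFun (rep_ofBounded _ (isBoundedAnalytic_pow n)) z

lemma bergman_inner_smul_left (f g : bergmanSpace) (c : ℂ) :
    inner ℂ (c • f) g = conj c * inner ℂ f g := _root_.inner_smul_left f g c

lemma bergman_inner_smul_right (f g : bergmanSpace) (c : ℂ) :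
    inner ℂ f (c • g) = c * inner ℂ f g := _root_.inner_smul_right f g c

lemma bergman_inner_self (f : bergmanSpace) : inner ℂ f f = (‖f‖ : ℂ) ^ 2 :=
  inner_self_eq_norm_sq_to_K f

lemma inner_eq_integral (f g : bergmanSpace) :
    inner ℂ f g = ∫ z, conj (rep f z) * rep g z ∂area := by
  rw [Submodule.coe_inner, L2.inner_def]
  refine integral_congr_ae ?_
  filter_upwards [ae_eq_rep f, ae_eq_rep g] with z h1 h2
  rw [h1, h2]
  simp [mul_comm]

lemma integrable_conj_mul (f g : bergmanSpace) :
    Integrable (fun z => conj (rep f z) * rep g z) area := by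
  refine (L2.integrable_inner (𝕜 := ℂ) f.1 g.1).congr ?_
  filter_upwards [ae_eq_rep f, ae_eq_rep g] with z h1 h2
  rw [h1, h2]
  simp [mul_comm]

lemma inner_mono_eq {g : bergmanSpace} {a : ℕ → ℂ}
    (ha : ∀ z : Disc, HasSum (fun n => a n * (z : ℂ) ^ n) (rep g z)) (n : ℕ) :
    inner ℂ (mono n) g = a n / (n + 1) := by
  obtain ⟨F, hF, hgF⟩ := isAnalytic_rep g
  have haF : ∀ z ∈ ball (0 : ℂ) 1, HasSum (fun n => a n * z ^ n) (F z) := fun z hz => by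
    simpa [hgF] using ha ⟨z, hz⟩
  have hi := integrable_conj_mul (mono n) g
  rw [inner_eq_integral]
  simp only [rep_mono, hgF] at hi ⊢
  rw [integral_area fun z => conj (z ^ n) * F z]
  have hint := integrableOn_of_integrable_area (G := fun z => conj (z ^ n) * F z) hi
  -- Termwise integration needs a radius below `1`; the discs of radius `r k` exhaust the unit disc
  -- and integrability of the product allows the limit.
  set r : ℕ → ℝ := fun k => 1 - 1 / ((k : ℝ) + 1) with hr
  have hr0 : ∀ k, 0 ≤ r k := fun k => by
    rw [hr, sub_nonneg, div_le_one (by positivity)]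
    linarith [(Nat.cast_nonneg k : (0 : ℝ) ≤ k)]
  have hr1 : ∀ k, r k < 1 := fun k => by
    have : (0 : ℝ) < 1 / ((k : ℝ) + 1) := by positivity
    simp only [hr]
    linarith
  have hrlim : Tendsto r atTop (𝓝 1) := by
    simpa [hr] using tendsto_one_div_add_atTop_nhds_zero_nat.const_sub (1 : ℝ)
  have hrm : Monotone r := fun i j hij => by
    have := one_div_le_one_div_of_le (by positivity : (0 : ℝ) < (i : ℝ) + 1)
      (by exact_mod_cast Nat.succ_le_succ hij : (i : ℝ) + 1 ≤ (j : ℝ) + 1)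
    simp only [hr]
    linarith
  have hU : ⋃ k, ball (0 : ℂ) (r k) = ball 0 1 := by
    ext z
    simp only [Set.mem_iUnion, mem_ball_zero_iff]
    exact ⟨fun ⟨k, hk⟩ => hk.trans (hr1 k), fun hz => (hrlim.eventually (lt_mem_nhds hz)).exists⟩
  have hl := tendsto_setIntegral_of_monotone (fun k => measurableSet_ball)
    (fun i j hij => ball_subset_ball (hrm hij)) (hU ▸ hint : IntegrableOn _ (⋃ k, ball (0 : ℂ) (r k)))
  rw [hU] at hl
  have hval : ∀ k, ∫ z in ball (0 : ℂ) (r k), conj (z ^ n) * F z =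
      a n * ((Real.pi * r k ^ (2 * n + 2) / (n + 1) : ℝ) : ℂ) := fun k => by
    rw [setIntegral_conj_pow_mul measurableSet_ball (isRadial_ball _) (hr0 k) (hr1 k) subset_rfl
      haF, integral_complex_ofReal, setIntegral_ball_norm_pow (hr0 k)]
  simp_rw [hval] at hl
  have hl2 : Tendsto (fun k => a n * ((Real.pi * r k ^ (2 * n + 2) / (n + 1) : ℝ) : ℂ)) atTop
      (𝓝 (a n * ((Real.pi * 1 ^ (2 * n + 2) / (n + 1) : ℝ) : ℂ))) :=
    (((Complex.continuous_ofReal.tendsto _).comp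
      (((hrlim.pow _).const_mul _).div_const _))).const_mul _
  rw [tendsto_nhds_unique hl hl2]
  have hpi : (Real.pi : ℂ) ≠ 0 := by exact_mod_cast Real.pi_ne_zero
  push_cast
  field_simp
  ring

/-- The power series of an element of the Bergman space. -/
lemma hasSum_rep (g : bergmanSpace) (z : Disc) :
    HasSum (fun n : ℕ => ((n + 1 : ℂ) * inner ℂ (mono n) g) * (z : ℂ) ^ n) (rep g z) := by
  obtain ⟨F, hF, hgF⟩ := isAnalytic_rep g
  obtain ⟨a, ha⟩ := exists_hasSum_of_differentiableOn hF
  have ha' : ∀ z : Disc, HasSum (fun n => a n * (z : ℂ) ^ n) (rep g z) := fun z => by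
    rw [hgF]
    exact ha z z.2
  refine (ha' z).congr_fun fun n => ?_
  rw [inner_mono_eq ha' n]
  have : (n : ℂ) + 1 ≠ 0 := by exact_mod_cast n.succ_ne_zero
  field_simp

lemma inner_mono_mono (n m : ℕ) :
    inner ℂ (mono n) (mono m) = if n = m then ((n : ℂ) + 1)⁻¹ else 0 := by
  rw [inner_mono_eq (a := fun k => if k = m then 1 else 0) (fun z => ?_)]
  · split_ifs <;> simp
  · rw [rep_mono]
    convert hasSum_single (f := fun k => (if k = m then (1 : ℂ) else 0) * (z : ℂ) ^ k) m ?_ using 1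
    · simp
    · intro k hk
      simp [hk]

/-- The pairings with monomials determine the Taylor coefficients. Operator identities for adjoints
are checked through this lemma. -/
lemma ext_inner_mono {f g : bergmanSpace} (h : ∀ n, inner ℂ (mono n) f = inner ℂ (mono n) g) :
    f = g :=
  ext_rep fun z => (hasSum_rep f z).unique (by simpa only [h] using hasSum_rep g z)

lemma orthonormal_smul_mono :
    Orthonormal ℂ fun n : ℕ => ((√((n : ℝ) + 1) : ℝ) : ℂ) • mono n := by
  rw [orthonormal_iff_ite]
  intro i j
  rw [bergman_inner_smul_left, bergman_inner_smul_right, inner_mono_mono, Complex.conj_ofReal]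
  split_ifs with h
  · subst h
    rw [← mul_assoc, ← Complex.ofReal_mul, Real.mul_self_sqrt (by positivity)]
    push_cast
    exact mul_inv_cancel₀ (by exact_mod_cast i.succ_ne_zero)
  · simp

/-- The orthonormal basis of normalized monomials. -/
noncomputable def monoBasis : HilbertBasis ℕ ℂ bergmanSpace :=
  HilbertBasis.mkOfOrthogonalEqBot orthonormal_smul_mono <| by
    rw [Submodule.eq_bot_iff]
    intro g hg
    refine ext_inner_mono fun n => ?_
    have h := (Submodule.mem_orthogonal _ _).1 hg _ (Submodule.subset_span ⟨n, rfl⟩)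
    beta_reduce at h
    rw [bergman_inner_smul_left, Complex.conj_ofReal] at h
    rw [inner_zero_right]
    refine (mul_eq_zero.1 h).resolve_left ?_
    exact_mod_cast (Real.sqrt_pos.2 (by positivity : (0 : ℝ) < (n : ℝ) + 1)).ne'

lemma hasSum_inner (f g : bergmanSpace) :
    HasSum (fun n : ℕ => (n + 1 : ℂ) * (inner ℂ f (mono n) * inner ℂ (mono n) g)) (inner ℂ f g) := by
  refine (monoBasis.hasSum_inner_mul_inner f g).congr_fun fun n => ?_
  have : monoBasis n = ((√((n : ℝ) + 1) : ℝ) : ℂ) • mono n := by simp [monoBasis]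
  have h2 : ((√((n : ℝ) + 1) : ℝ) : ℂ) * ((√((n : ℝ) + 1) : ℝ) : ℂ) = n + 1 := by
    rw [← Complex.ofReal_mul, Real.mul_self_sqrt (by positivity)]
    push_cast
    rfl
  rw [this, bergman_inner_smul_left, bergman_inner_smul_right, Complex.conj_ofReal, ← h2]
  ring

/-- Parseval for the normalized monomials; the weight `n + 1` is `1/‖zⁿ‖²`. -/
lemma hasSum_norm_sq (g : bergmanSpace) :
    HasSum (fun n : ℕ => ((n : ℝ) + 1) * ‖inner ℂ (mono n) g‖ ^ 2) (‖g‖ ^ 2) := by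
  have h := hasSum_inner g g
  rw [bergman_inner_self] at h
  rw [← Complex.hasSum_ofReal]
  push_cast
  refine h.congr_fun fun n => ?_
  rw [← inner_conj_symm g, Complex.conj_mul']

/-! ### The Hardy form and its behaviour under multiplication operators. -/

/-- Multiplication by a bounded function is bounded for the Hardy norm. -/
lemma sum_norm_sq_le_of_norm_le {a d : ℕ → ℂ} {F G : ℂ → ℂ} {C A : ℝ}
    (hFd : DifferentiableOn ℂ F (ball 0 1)) (hGd : DifferentiableOn ℂ G (ball 0 1))
    (hF : ∀ z ∈ ball (0 : ℂ) 1, HasSum (fun n => a n * z ^ n) (F z))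
    (hG : ∀ z ∈ ball (0 : ℂ) 1, HasSum (fun n => d n * z ^ n) (G z))
    (hle : ∀ z ∈ ball (0 : ℂ) 1, ‖G z‖ ≤ C * ‖F z‖)
    (hA : HasSum (fun n => ‖a n‖ ^ 2) A) (M : ℕ) :
    ∑ m ∈ Finset.range M, ‖d m‖ ^ 2 ≤ C ^ 2 * A := by
  have key : ∀ r ∈ Set.Ioo (0 : ℝ) 1,
      ∑ m ∈ Finset.range M, ‖d m‖ ^ 2 * r ^ (2 * m) ≤ C ^ 2 * A := by
    intro r hr
    set R : ℝ := (1 + r) / 2 with hR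
    have hrR : r < R := by linarith [hr.2]
    have hR1 : R < 1 := by linarith [hr.2]
    have hR0 : 0 ≤ R := by linarith [hr.1]
    -- An annulus replaces the circle of radius `r`: on it `|z|^{2n}` lies between `r^{2n}` and `1`,
    -- so area integrals over `s` divided by its area compare with the Hardy sums. Letting `r → 1`
    -- removes the loss.
    set s : Set ℂ := ball 0 R \ ball 0 r with hs
    have hsm : MeasurableSet s := measurableSet_ball.diff measurableSet_ball
    have hsR : s ⊆ ball 0 R := Set.sdiff_subset
    have hfin : volume s ≠ ⊤ := ((measure_mono hsR).trans_lt measure_ball_lt_top).ne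
    have hV : 0 < volume.real s := by
      refine ENNReal.toReal_pos (ne_of_gt ?_) hfin
      have ho : IsOpen (ball (0 : ℂ) R \ closedBall 0 r) := isOpen_ball.sdiff isClosed_closedBall
      refine (ho.measure_pos volume ⟨((r + R) / 2 : ℝ), ?_⟩).trans_le
        (measure_mono (Set.sdiff_subset_sdiff_right ball_subset_closedBall))
      have h0 : 0 ≤ (r + R) / 2 := by linarith [hr.1]
      rw [Set.mem_sdiff, mem_ball_zero_iff, mem_closedBall_zero_iff, Complex.norm_real,
        Real.norm_of_nonneg h0]
      constructor <;> linarith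
    have hmom : ∀ n, IntegrableOn (fun z : ℂ => ‖z‖ ^ (2 * n)) s := fun n =>
      ((Continuous.continuousOn (by fun_prop)).integrableOn_compact
        (isCompact_closedBall (0 : ℂ) R)).mono_set (hsR.trans ball_subset_closedBall)
    have hmom_ge : ∀ n, r ^ (2 * n) * volume.real s ≤ ∫ z in s, ‖z‖ ^ (2 * n) := by
      intro n
      rw [mul_comm, ← smul_eq_mul, ← setIntegral_const]
      refine setIntegral_mono_on (integrableOn_const hfin) (hmom n) hsm fun z hz => ?_
      have : r ≤ ‖z‖ := by simpa using hz.2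
      exact pow_le_pow_left₀ hr.1.le this _
    have hmom_le : ∀ n, ∫ z in s, ‖z‖ ^ (2 * n) ≤ volume.real s := by
      intro n
      have h1 : volume.real s = ∫ _ in s, (1 : ℝ) := by simp
      rw [h1]
      refine setIntegral_mono_on (hmom n) (integrableOn_const hfin) hsm fun z hz => ?_
      exact pow_le_one₀ (norm_nonneg _) ((mem_ball_zero_iff.1 (hsR hz)).le.trans hR1.le)
    have hPF := hasSum_setIntegral_normSq hsm (isRadial_annulus r R) hR0 hR1 hsR hFd hF
    have hPG := hasSum_setIntegral_normSq hsm (isRadial_annulus r R) hR0 hR1 hsR hGd hG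
    have hsub : closedBall (0 : ℂ) R ⊆ ball 0 1 := closedBall_subset_ball hR1
    have hint : ∀ H : ℂ → ℂ, DifferentiableOn ℂ H (ball 0 1) →
        IntegrableOn (fun z => ‖H z‖ ^ 2) s := fun H hH =>
      (((hH.continuousOn.mono hsub).norm.pow 2).integrableOn_compact
        (isCompact_closedBall 0 R)).mono_set (hsR.trans ball_subset_closedBall)
    have h1 : ∑ m ∈ Finset.range M, ‖d m‖ ^ 2 * r ^ (2 * m) * volume.real s ≤
        ∫ z in s, ‖G z‖ ^ 2 := by
      refine le_trans (Finset.sum_le_sum fun m _ => ?_)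
        (sum_le_hasSum (Finset.range M) (fun m _ => ?_) hPG)
      · rw [mul_assoc]
        exact mul_le_mul_of_nonneg_left (hmom_ge m) (by positivity)
      · exact mul_nonneg (by positivity) (integral_nonneg fun z => by positivity)
    have h2 : ∫ z in s, ‖G z‖ ^ 2 ≤ C ^ 2 * ∫ z in s, ‖F z‖ ^ 2 := by
      rw [← integral_const_mul]
      refine setIntegral_mono_on (hint G hGd) ((hint F hFd).const_mul _) hsm fun z hz => ?_
      rw [← mul_pow]
      exact pow_le_pow_left₀ (norm_nonneg _) (hle z (hsub (ball_subset_closedBall (hsR hz)))) _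
    have h3 : ∫ z in s, ‖F z‖ ^ 2 ≤ A * volume.real s :=
      hasSum_le (fun n => mul_le_mul_of_nonneg_left (hmom_le n) (by positivity)) hPF
        (hA.mul_right _)
    rw [← Finset.sum_mul] at h1
    have h4 := h1.trans (h2.trans (mul_le_mul_of_nonneg_left h3 (sq_nonneg C)))
    rw [← mul_assoc] at h4
    exact le_of_mul_le_mul_right h4 hV
  have hc : Continuous fun r : ℝ => ∑ m ∈ Finset.range M, ‖d m‖ ^ 2 * r ^ (2 * m) := by fun_prop
  have hlim := (hc.tendsto 1).mono_left (nhdsWithin_le_nhds (s := Set.Iio 1))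
  have := le_of_tendsto hlim (by
    filter_upwards [Ioo_mem_nhdsLT (zero_lt_one' ℝ)] with r hr using key r hr)
  simpa using this

/-- Cauchy–Schwarz for a convergent series. -/
lemma norm_sq_le_of_hasSum {d x : ℕ → ℂ} {t : ℂ} {D X : ℝ}
    (h : HasSum (fun n => d n * x n) t)
    (hD : ∀ M, ∑ m ∈ Finset.range M, ‖d m‖ ^ 2 ≤ D)
    (hX : ∀ M, ∑ m ∈ Finset.range M, ‖x m‖ ^ 2 ≤ X) : ‖t‖ ^ 2 ≤ D * X := by
  refine le_of_tendsto ((h.tendsto_sum_nat.norm).pow 2) (.of_forall fun M => ?_)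
  have hD0 : 0 ≤ D := by simpa using hD 0
  calc ‖∑ m ∈ Finset.range M, d m * x m‖ ^ 2
      ≤ (∑ m ∈ Finset.range M, ‖d m‖ * ‖x m‖) ^ 2 := by
        refine pow_le_pow_left₀ (norm_nonneg _) ((norm_sum_le _ _).trans_eq ?_) 2
        simp_rw [norm_mul]
    _ ≤ (∑ m ∈ Finset.range M, ‖d m‖ ^ 2) * ∑ m ∈ Finset.range M, ‖x m‖ ^ 2 :=
        Finset.sum_mul_sq_le_sq_mul_sq _ _ _
    _ ≤ D * X := mul_le_mul (hD M) (hX M) (by positivity) hD0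

/-- The quadratic form `∑ₙ |⟨zⁿ, g⟩|²`, i.e. `⟨(I - T_z T_z^*) g, g⟩`. -/
noncomputable def hardyForm (g : bergmanSpace) : ℝ := ∑' n, ‖inner ℂ (mono n) g‖ ^ 2

lemma hasSum_hardyForm (g : bergmanSpace) :
    HasSum (fun n => ‖inner ℂ (mono n) g‖ ^ 2) (hardyForm g) := by
  refine Summable.hasSum (.of_nonneg_of_le (fun n => by positivity) (fun n => ?_)
    (hasSum_norm_sq g).summable)
  exact le_mul_of_one_le_left (by positivity) (by simp)

lemma hardyForm_nonneg (g : bergmanSpace) : 0 ≤ hardyForm g :=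
  (hasSum_hardyForm g).nonneg fun n => by positivity

lemma sum_le_hardyForm (g : bergmanSpace) (N : ℕ) :
    ∑ n ∈ Finset.range N, ‖inner ℂ (mono n) g‖ ^ 2 ≤ hardyForm g :=
  sum_le_hasSum _ (fun n _ => by positivity) (hasSum_hardyForm g)

lemma isBoundedAnalytic_id : IsBoundedAnalytic fun z : Disc => (z : ℂ) := by
  simpa using isBoundedAnalytic_pow 1

/-- The Bergman shift. -/
noncomputable def shift : bergmanSpace →L[ℂ] bergmanSpace := mulOp _ isBoundedAnalytic_id

lemma shift_mono (n : ℕ) : shift (mono n) = mono (n + 1) :=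
  ext_rep fun z => by simp [shift, rep_mulOp, pow_succ']

lemma inner_mono_adjoint_shift (n : ℕ) (g : bergmanSpace) :
    inner ℂ (mono n) (shift.adjoint g) = inner ℂ (mono (n + 1)) g := by
  rw [ContinuousLinearMap.adjoint_inner_right, shift_mono]

/-- `S^*` moves the coefficient pairings by one place, so its norm carries the weight `n` where
`‖g‖²` carries `n + 1`. -/
lemma norm_sq_adjoint_shift (g : bergmanSpace) :
    ‖g‖ ^ 2 - ‖shift.adjoint g‖ ^ 2 = hardyForm g := by
  have h1 := hasSum_norm_sq (shift.adjoint g)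
  simp_rw [inner_mono_adjoint_shift] at h1
  have h2 : HasSum (fun n : ℕ => (n : ℝ) * ‖inner ℂ (mono n) g‖ ^ 2)
      (‖shift.adjoint g‖ ^ 2) := by
    rw [← hasSum_nat_add_iff' 1]
    simpa using h1
  refine ((hasSum_norm_sq g).sub h2).unique ((hasSum_hardyForm g).congr_fun fun n => ?_)
  ring

lemma rep_sum (s : Finset ℕ) (f : ℕ → bergmanSpace) (z : Disc) :
    rep (∑ n ∈ s, f n) z = ∑ n ∈ s, rep (f n) z := by
  exact map_sum (ev z) f s

/-- The polynomial with prescribed coefficients, as an element of the Bergman space. -/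
noncomputable def partialSum (x : ℕ → ℂ) (N : ℕ) : bergmanSpace :=
  ∑ n ∈ Finset.range N, x n • mono n

lemma inner_partialSum (x : ℕ → ℂ) (N : ℕ) (g : bergmanSpace) :
    inner ℂ (partialSum x N) g = ∑ n ∈ Finset.range N, conj (x n) * inner ℂ (mono n) g := by
  rw [partialSum, sum_inner]
  exact Finset.sum_congr rfl fun n _ => bergman_inner_smul_left _ _ _

lemma rep_partialSum (x : ℕ → ℂ) (N : ℕ) (z : Disc) :
    rep (partialSum x N) z = ∑ n ∈ Finset.range N, x n * (z : ℂ) ^ n := by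
  rw [partialSum, rep_sum]
  exact Finset.sum_congr rfl fun n _ => by simp [rep_smul]

lemma sum_norm_sq_mulOp_partialSum_le {b : Disc → ℂ} (hb : IsBoundedAnalytic b) {C : ℝ}
    (hC : ∀ z, ‖b z‖ ≤ C) (x : ℕ → ℂ) (N M : ℕ) :
    ∑ m ∈ Finset.range M, ‖((m : ℂ) + 1) * inner ℂ (mono m) (mulOp b hb (partialSum x N))‖ ^ 2 ≤
      C ^ 2 * ∑ n ∈ Finset.range N, ‖x n‖ ^ 2 := by
  obtain ⟨F, hFd, hF⟩ := isAnalytic_rep (partialSum x N)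
  obtain ⟨G, hGd, hG⟩ := isAnalytic_rep (mulOp b hb (partialSum x N))
  set a : ℕ → ℂ := fun n => if n < N then x n else 0 with ha
  have hFs : ∀ z ∈ ball (0 : ℂ) 1, HasSum (fun n => a n * z ^ n) (F z) := by
    intro z hz
    have h1 : F z = ∑ n ∈ Finset.range N, a n * z ^ n := by
      rw [← hF ⟨z, hz⟩, rep_partialSum]
      exact Finset.sum_congr rfl fun n hn => by simp [ha, Finset.mem_range.1 hn]
    rw [h1]
    exact hasSum_sum_of_ne_finset_zero fun n hn => by
      simp [ha, Finset.mem_range.not.1 hn]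
  have hA : HasSum (fun n => ‖a n‖ ^ 2) (∑ n ∈ Finset.range N, ‖x n‖ ^ 2) := by
    have h1 : ∑ n ∈ Finset.range N, ‖x n‖ ^ 2 = ∑ n ∈ Finset.range N, ‖a n‖ ^ 2 :=
      Finset.sum_congr rfl fun n hn => by simp [ha, Finset.mem_range.1 hn]
    rw [h1]
    exact hasSum_sum_of_ne_finset_zero fun n hn => by
      simp [ha, Finset.mem_range.not.1 hn]
  refine sum_norm_sq_le_of_norm_le hFd hGd hFs (fun z hz => ?_) (fun z hz => ?_) hA M
  · rw [← hG ⟨z, hz⟩]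
    exact hasSum_rep (mulOp b hb (partialSum x N)) ⟨z, hz⟩
  · rw [← hG ⟨z, hz⟩, ← hF ⟨z, hz⟩, rep_mulOp, Pi.mul_apply, norm_mul]
    exact mul_le_mul_of_nonneg_right (hC _) (norm_nonneg _)

/-- Co-analytic Toeplitz operators are bounded for `hardyForm`. -/
lemma hardyForm_adjoint_mulOp_le {b : Disc → ℂ} (hb : IsBoundedAnalytic b) {C : ℝ}
    (hC : ∀ z, ‖b z‖ ≤ C) (g : bergmanSpace) :
    hardyForm ((mulOp b hb).adjoint g) ≤ C ^ 2 * hardyForm g := by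
  refine le_of_tendsto (hasSum_hardyForm _).tendsto_sum_nat (.of_forall fun N => ?_)
  set s : ℝ := ∑ n ∈ Finset.range N, ‖inner ℂ (mono n) ((mulOp b hb).adjoint g)‖ ^ 2 with hs
  have hs0 : 0 ≤ s := by positivity
  -- Duality: `p` has the coefficients `⟨zⁿ, M_b^* g⟩` for `n < N`, so `⟨b p, g⟩ = ⟨p, M_b^* g⟩ =
  -- s`. The Hardy norm of `b p` squared is at most `C² s`, and Cauchy–Schwarz yields `s² ≤ C² s
  -- Q(g)`.
  obtain ⟨p, hp⟩ : ∃ p, p = partialSum (fun n => inner ℂ (mono n) ((mulOp b hb).adjoint g)) N :=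
    ⟨_, rfl⟩
  have hbound : ∀ M, ∑ m ∈ Finset.range M, ‖((m : ℂ) + 1) * inner ℂ (mono m) (mulOp b hb p)‖ ^ 2 ≤
      C ^ 2 * s := hp ▸ sum_norm_sq_mulOp_partialSum_le hb hC _ N
  have hsum := hasSum_inner (mulOp b hb p) g
  have hval : inner ℂ (mulOp b hb p) g = (s : ℂ) := by
    rw [← ContinuousLinearMap.adjoint_inner_right, hp, inner_partialSum, hs]
    push_cast
    exact Finset.sum_congr rfl fun n _ => Complex.conj_mul' _
  rw [hval] at hsum
  have hcs := norm_sq_le_of_hasSum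
    (d := fun n => (n + 1 : ℂ) * inner ℂ (mulOp b hb p) (mono n))
    (x := fun n => inner ℂ (mono n) g) (hsum.congr_fun fun n => by ring)
    (D := C ^ 2 * s) (fun M => by
      refine le_trans (Finset.sum_le_sum fun m _ => ?_) (hbound M)
      rw [norm_mul, norm_mul, norm_inner_symm (mulOp b hb p) (mono m)]) (sum_le_hardyForm g)
  rw [Complex.norm_real, Real.norm_of_nonneg hs0] at hcs
  change s ≤ _
  rcases hs0.eq_or_lt with h | h
  · rw [← h]
    exact mul_nonneg (sq_nonneg C) (hardyForm_nonneg g)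
  · refine le_of_mul_le_mul_left ?_ h
    linarith

/-! ### Abstract Hilbert space lemmas: factorization, square roots, telescoping. -/

section Hilbert

variable {H : Type*} [NormedAddCommGroup H] [InnerProductSpace ℂ H] [CompleteSpace H]

/-- A functional dominated by `‖R g‖` factors through `R`. -/
lemma exists_eq_inner_of_norm_le (R : H →L[ℂ] H) (l : H →ₗ[ℂ] ℂ) {C : ℝ}
    (h : ∀ g, ‖l g‖ ≤ C * ‖R g‖) : ∃ k : H, ∀ g, l g = inner ℂ k (R g) := by
  have hker : LinearMap.ker (R : H →ₗ[ℂ] H) ≤ LinearMap.ker l := fun g hg => by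
    rw [LinearMap.mem_ker, ContinuousLinearMap.coe_coe] at hg
    simpa [hg] using h g
  have hl : l ∈ LinearMap.range (R : H →ₗ[ℂ] H).dualMap := by
    rw [LinearMap.range_dualMap_eq_dualAnnihilator_ker, Submodule.mem_dualAnnihilator]
    exact fun w hw => hker hw
  obtain ⟨m, hm⟩ := hl
  have hm' : ∀ g, l g = m (R g) := fun g => by rw [← hm]; rfl
  -- The range of `R` need not be closed; Hahn–Banach extends the bounded functional from it to `H`,
  -- and Riesz then represents it.
  obtain ⟨M, hM, -⟩ := exists_extension_norm_eq (LinearMap.range (R : H →ₗ[ℂ] H))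
    ((m.comp (LinearMap.range (R : H →ₗ[ℂ] H)).subtype).mkContinuous C (by
      rintro ⟨_, g, rfl⟩
      simpa [← hm'] using h g))
  refine ⟨(InnerProductSpace.toDual ℂ H).symm M, fun g => ?_⟩
  rw [InnerProductSpace.toDual_symm_apply, hm']
  exact (hM ⟨R g, g, rfl⟩).symm

lemma nonneg_one_sub_comp_adjoint {T : H →L[ℂ] H} (hT : ∀ g, ‖T.adjoint g‖ ≤ ‖g‖) :
    0 ≤ 1 - T ∘L T.adjoint := by
  rw [ContinuousLinearMap.nonneg_iff_isPositive]
  refine ⟨?_, fun g => ?_⟩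
  · have h1 : IsSelfAdjoint (1 - T ∘L T.adjoint) :=
      (IsSelfAdjoint.one _).sub (ContinuousLinearMap.isPositive_self_comp_adjoint T).isSelfAdjoint
    exact ContinuousLinearMap.isSelfAdjoint_iff_isSymmetric.1 h1
  · rw [ContinuousLinearMap.reApplyInnerSelf_apply]
    simp only [_root_.sub_apply, one_apply_eq_self,
      ContinuousLinearMap.comp_apply, inner_sub_left, map_sub, inner_self_eq_norm_sq]
    rw [← ContinuousLinearMap.adjoint_inner_right, inner_self_eq_norm_sq, sub_nonneg]
    exact pow_le_pow_left₀ (norm_nonneg _) (hT g) 2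

lemma inner_sqrtOp (A : H →L[ℂ] H) (f g : H) :
    inner ℂ (sqrtOp A f) g = inner ℂ f (sqrtOp A g) := by
  have h : IsSelfAdjoint (sqrtOp A) := IsSelfAdjoint.of_nonneg (CFC.sqrt_nonneg A)
  exact ContinuousLinearMap.isSelfAdjoint_iff_isSymmetric.1 h f g

lemma norm_sq_sqrtOp {T : H →L[ℂ] H} (hT : ∀ g, ‖T.adjoint g‖ ≤ ‖g‖) (g : H) :
    ‖sqrtOp (1 - T ∘L T.adjoint) g‖ ^ 2 = ‖g‖ ^ 2 - ‖T.adjoint g‖ ^ 2 := by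
  have h1 : sqrtOp (1 - T ∘L T.adjoint) (sqrtOp (1 - T ∘L T.adjoint) g) =
      (1 - T ∘L T.adjoint) g := by
    conv_rhs => rw [← CFC.sqrt_mul_sqrt_self _ (nonneg_one_sub_comp_adjoint hT)]
    rfl
  rw [← inner_self_eq_norm_sq (𝕜 := ℂ), inner_sqrtOp, h1]
  simp only [_root_.sub_apply, one_apply_eq_self,
    ContinuousLinearMap.comp_apply, inner_sub_right, map_sub, inner_self_eq_norm_sq]
  rw [← ContinuousLinearMap.adjoint_inner_left, inner_self_eq_norm_sq]

/-- Cauchy–Schwarz for the form `α(g) - α(S^* g)` with `α(g) = ⟨(I - TT^*) g, g⟩`, against a unit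
vector in the kernel of `S^*`. -/
lemma norm_inner_sq_le_of_nonneg {S T : H →L[ℂ] H} {e : H} (he : ‖e‖ ≤ 1)
    (hSe : S.adjoint e = 0)
    (hpos : ∀ g, 0 ≤ (‖g‖ ^ 2 - ‖T.adjoint g‖ ^ 2) -
      (‖S.adjoint g‖ ^ 2 - ‖T.adjoint (S.adjoint g)‖ ^ 2)) (g : H) :
    ‖inner ℂ (e - T (T.adjoint e)) g‖ ^ 2 ≤ (‖g‖ ^ 2 - ‖T.adjoint g‖ ^ 2) -
      (‖S.adjoint g‖ ^ 2 - ‖T.adjoint (S.adjoint g)‖ ^ 2) := by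
  set c := inner ℂ (e - T (T.adjoint e)) g with hc
  -- Subtracting `c • e` leaves `S^* g` unchanged. Expanding, the cross terms contribute `-2|c|²`
  -- and the quadratic term at most `|c|²‖e‖² ≤ |c|²`, which leaves the claim.
  have h := hpos (g - c • e)
  have hS : S.adjoint (g - c • e) = S.adjoint g := by rw [map_sub, map_smul, hSe]; simp
  rw [hS, map_sub, map_smul, @norm_sub_sq ℂ, @norm_sub_sq ℂ] at h
  have h1 : inner ℂ g (c • e) - inner ℂ (T.adjoint g) (c • T.adjoint e) = (‖c‖ ^ 2 : ℝ) := by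
    have h2 : inner ℂ (T.adjoint g) (T.adjoint e) = inner ℂ g (T (T.adjoint e)) := by
      rw [ContinuousLinearMap.adjoint_inner_left]
    rw [inner_smul_right, inner_smul_right, h2, ← mul_sub, ← inner_sub_right, ← inner_conj_symm g,
      ← hc, Complex.mul_conj']
    push_cast
    rfl
  have h3 := congrArg Complex.re h1
  rw [Complex.sub_re, Complex.ofReal_re] at h3
  simp only [RCLike.re_to_complex, norm_smul, mul_pow] at h
  have h4 : ‖c‖ ^ 2 * ‖e‖ ^ 2 ≤ ‖c‖ ^ 2 :=
    mul_le_of_le_one_right (by positivity) (pow_le_one₀ (norm_nonneg _) he)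
  have h5 : 0 ≤ ‖c‖ ^ 2 * ‖T.adjoint e‖ ^ 2 := by positivity
  linarith

/-- The one-step bounds telescope along `S^{*n} g`; the remainder is a defect of `T` and hence
nonnegative. -/
lemma sum_norm_inner_sq_le {S T : H →L[ℂ] H} {e : H} (he : ‖e‖ ≤ 1)
    (hSe : S.adjoint e = 0) (hT : ∀ g, ‖T.adjoint g‖ ≤ ‖g‖)
    (hpos : ∀ g, 0 ≤ (‖g‖ ^ 2 - ‖T.adjoint g‖ ^ 2) -
      (‖S.adjoint g‖ ^ 2 - ‖T.adjoint (S.adjoint g)‖ ^ 2)) (g : H) (N : ℕ) :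
    ∑ n ∈ Finset.range N, ‖inner ℂ (e - T (T.adjoint e)) ((S.adjoint)^[n] g)‖ ^ 2 ≤
      ‖g‖ ^ 2 - ‖T.adjoint g‖ ^ 2 := by
  have h1 : ∑ n ∈ Finset.range N, ‖inner ℂ (e - T (T.adjoint e)) ((S.adjoint)^[n] g)‖ ^ 2 ≤
      (‖g‖ ^ 2 - ‖T.adjoint g‖ ^ 2) -
        (‖(S.adjoint)^[N] g‖ ^ 2 - ‖T.adjoint ((S.adjoint)^[N] g)‖ ^ 2) := by
    induction N with
    | zero => simp
    | succ N ih =>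
      rw [Finset.sum_range_succ, Function.iterate_succ_apply']
      linarith [norm_inner_sq_le_of_nonneg he hSe hpos ((S.adjoint)^[N] g)]
  have h2 := pow_le_pow_left₀ (norm_nonneg _) (hT ((S.adjoint)^[N] g)) 2
  linarith

end Hilbert

/-! ### Adjoints of multiplication operators and the defect form. -/

lemma adjoint_mulOp_mul {b c : Disc → ℂ} (hb : IsBoundedAnalytic b) (hc : IsBoundedAnalytic c)
    (g : bergmanSpace) :
    (mulOp (b * c) (hb.mul hc)).adjoint g = (mulOp c hc).adjoint ((mulOp b hb).adjoint g) := by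
  refine ext_inner_mono fun n => ?_
  simp only [ContinuousLinearMap.adjoint_inner_right]
  rw [mulOp_mul]

lemma adjoint_mulOp_comm {b c : Disc → ℂ} (hb : IsBoundedAnalytic b) (hc : IsBoundedAnalytic c)
    (g : bergmanSpace) : (mulOp c hc).adjoint ((mulOp b hb).adjoint g) =
      (mulOp b hb).adjoint ((mulOp c hc).adjoint g) := by
  refine ext_inner_mono fun n => ?_
  simp only [ContinuousLinearMap.adjoint_inner_right]
  congr 1
  exact ext_rep fun z => by simp only [rep_mulOp, Pi.mul_apply]; ring

lemma adjoint_mulOp_adjoint_mulOp_of_mul_eq_one {b c : Disc → ℂ} (hb : IsBoundedAnalytic b)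
    (hc : IsBoundedAnalytic c) (h : ∀ z, b z * c z = 1) (g : bergmanSpace) :
    (mulOp c hc).adjoint ((mulOp b hb).adjoint g) = g := by
  rw [← adjoint_mulOp_mul hb hc]
  refine ext_inner_mono fun n => ?_
  rw [ContinuousLinearMap.adjoint_inner_right]
  congr 1
  exact ext_rep fun z => by rw [rep_mulOp, Pi.mul_apply, Pi.mul_apply, h, one_mul]

lemma norm_adjoint_mulOp_le {b : Disc → ℂ} (hb : IsBoundedAnalytic b) (h1 : ∀ z, ‖b z‖ ≤ 1)
    (g : bergmanSpace) : ‖(mulOp b hb).adjoint g‖ ≤ ‖g‖ := by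
  have h : ‖mulOp b hb‖ ≤ 1 := by
    refine ContinuousLinearMap.opNorm_le_bound _ zero_le_one fun f => ?_
    rw [one_mul]
    refine Lp.norm_le_norm_of_ae_le ?_
    filter_upwards [ae_eq_rep (mulOp b hb f), ae_eq_rep f] with z h2 h3
    change ‖(mulOp b hb f).1 z‖ ≤ ‖f.1 z‖
    rw [h2, h3, rep_mulOp, Pi.mul_apply, norm_mul]
    exact mul_le_of_le_one_left (norm_nonneg _) (h1 z)
  have h2 : ‖(mulOp b hb).adjoint‖ ≤ 1 := by rwa [LinearIsometryEquiv.norm_map]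
  exact ((mulOp b hb).adjoint.le_of_opNorm_le h2 g).trans_eq (one_mul _)

/-- The positive square root of `I - T_b T_b^*`. -/
noncomputable def defectRoot (b : Disc → ℂ) (hb : IsBoundedAnalytic b) :
    bergmanSpace →L[ℂ] bergmanSpace :=
  sqrtOp (1 - mulOp b hb ∘L (mulOp b hb).adjoint)

lemma mem_subBergmanSpace_iff {b : Disc → ℂ} (hb : b ∈ unitBallHInfty) {f : Disc → ℂ} :
    f ∈ subBergmanSpace ((memLp_of_mem_unitBallHInfty hb).toLp b) ↔
      ∃ h, f = rep (defectRoot b (isBoundedAnalytic_of_mem hb) h) := by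
  rw [subBergmanSpace, toeplitz_star]
  constructor
  · rintro ⟨hf, h, e⟩
    exact ⟨h, (rep_eq hf e.symm).symm⟩
  · rintro ⟨h, rfl⟩
    exact ⟨isAnalytic_rep _, h, (ae_eq_rep _).symm⟩

lemma inner_defectRoot {b : Disc → ℂ} (hb : IsBoundedAnalytic b) (f g : bergmanSpace) :
    inner ℂ (defectRoot b hb f) g = inner ℂ f (defectRoot b hb g) :=
  inner_sqrtOp _ f g

lemma norm_sq_defectRoot {b : Disc → ℂ} (hb : IsBoundedAnalytic b) (h1 : ∀ z, ‖b z‖ ≤ 1)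
    (g : bergmanSpace) :
    ‖defectRoot b hb g‖ ^ 2 = ‖g‖ ^ 2 - ‖(mulOp b hb).adjoint g‖ ^ 2 :=
  norm_sq_sqrtOp (norm_adjoint_mulOp_le hb h1) g

/-! ### The Hardy space inside the sub-Bergman space. -/

/-- The origin, as a point of the disc. -/
def origin : Disc := ⟨0, by simp⟩

lemma inner_mono_zero (g : bergmanSpace) : inner ℂ (mono 0) g = rep g origin := by
  refine HasSum.unique ?_ (hasSum_rep g origin)
  convert hasSum_single
    (f := fun n : ℕ => ((n + 1 : ℂ) * inner ℂ (mono n) g) * ((origin : Disc) : ℂ) ^ n) 0 ?_ using 1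
  · simp
  · intro n hn
    simp [origin, hn]

lemma norm_mono_zero : ‖mono 0‖ ≤ 1 := by
  have h := bergman_inner_self (mono 0)
  rw [inner_mono_mono] at h
  have h2 : ‖mono 0‖ ^ 2 = 1 := by
    rw [← Complex.ofReal_inj]
    push_cast
    rw [← h]
    simp
  nlinarith [norm_nonneg (mono 0)]

lemma adjoint_shift_mono_zero : shift.adjoint (mono 0) = 0 := by
  refine ext_inner_mono fun n => ?_
  rw [inner_mono_adjoint_shift, inner_mono_mono, inner_zero_right]
  simp

/-- The constant `1` is the reproducing kernel at the origin, hence an eigenvector of every `M_b^*`.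
-/
lemma adjoint_mulOp_mono_zero {b : Disc → ℂ} (hb : IsBoundedAnalytic b) :
    (mulOp b hb).adjoint (mono 0) = conj (b origin) • mono 0 := by
  refine ext_inner_mono fun n => ?_
  rw [ContinuousLinearMap.adjoint_inner_right, ← inner_conj_symm (mulOp b hb (mono n)),
    inner_mono_zero, rep_mulOp, Pi.mul_apply, rep_mono, bergman_inner_smul_right, inner_mono_mono]
  rcases n with _ | n <;> simp [origin]

lemma inner_iterate_adjoint_shift (x g : bergmanSpace) (n : ℕ) :
    inner ℂ x ((shift.adjoint)^[n] g) = inner ℂ (shift^[n] x) g := by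
  induction n generalizing g with
  | zero => rfl
  | succ n ih =>
    rw [Function.iterate_succ_apply, ih, ContinuousLinearMap.adjoint_inner_right,
      Function.iterate_succ_apply']

lemma rep_iterate_shift (x : bergmanSpace) (n : ℕ) (z : Disc) :
    rep (shift^[n] x) z = (z : ℂ) ^ n * rep x z := by
  induction n with
  | zero => simp
  | succ n ih =>
    rw [Function.iterate_succ_apply', shift, rep_mulOp, Pi.mul_apply]
    change (z : ℂ) * rep (shift^[n] x) z = _
    rw [ih]
    ring

/-- The reproducing kernel at the origin of the de Branges–Rovnyak space of `b`. -/
def kernelAtOrigin (b : Disc → ℂ) : Disc → ℂ := fun z => 1 - conj (b origin) * b z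

lemma isBoundedAnalytic_kernelAtOrigin {b : Disc → ℂ} (hb : IsBoundedAnalytic b) :
    IsBoundedAnalytic (kernelAtOrigin b) := by
  obtain ⟨⟨F, hF, hbF⟩, C, hC⟩ := hb
  refine ⟨⟨fun z => 1 - conj (b origin) * F z, (hF.const_mul _).const_sub _,
    fun z => by simp [kernelAtOrigin, hbF]⟩, 1 + ‖b origin‖ * C, fun z => ?_⟩
  refine (norm_sub_le _ _).trans ?_
  rw [norm_one, norm_mul, RCLike.norm_conj]
  gcongr
  exact hC z

/-- As `M_b^*` and `S^*` commute, the four terms regroup into `Q(g) - Q(M_b^* g)`, and `M_b^*`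
contracts `Q`. -/
lemma defect_sub_defect_adjoint_shift_nonneg {b : Disc → ℂ} (hb : IsBoundedAnalytic b)
    (h1 : ∀ z, ‖b z‖ ≤ 1) (g : bergmanSpace) :
    0 ≤ (‖g‖ ^ 2 - ‖(mulOp b hb).adjoint g‖ ^ 2) -
      (‖shift.adjoint g‖ ^ 2 - ‖(mulOp b hb).adjoint (shift.adjoint g)‖ ^ 2) := by
  have hcomm : (mulOp b hb).adjoint (shift.adjoint g) = shift.adjoint ((mulOp b hb).adjoint g) :=
    adjoint_mulOp_comm isBoundedAnalytic_id hb g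
  have h2 := hardyForm_adjoint_mulOp_le hb h1 g
  rw [one_pow, one_mul] at h2
  rw [hcomm, sub_sub_sub_comm]
  exact sub_nonneg.2 ((norm_sq_adjoint_shift _).trans_le
    (h2.trans_eq (norm_sq_adjoint_shift g).symm))

lemma iterate_shift_defect_mono_zero {b : Disc → ℂ} (hb : IsBoundedAnalytic b) (n : ℕ) :
    shift^[n] (mono 0 - mulOp b hb ((mulOp b hb).adjoint (mono 0))) =
      mulOp _ (isBoundedAnalytic_kernelAtOrigin hb) (mono n) := by
  refine ext_rep fun z => ?_
  rw [rep_iterate_shift, rep_mulOp, adjoint_mulOp_mono_zero, sub_eq_add_neg, ← neg_one_smul ℂ,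
    rep_add, rep_smul, map_smul, rep_smul]
  simp [rep_mulOp, kernelAtOrigin]
  ring

lemma sum_norm_inner_defect_le {b : Disc → ℂ} (hb : IsBoundedAnalytic b)
    (h1 : ∀ z, ‖b z‖ ≤ 1) (g : bergmanSpace) (N : ℕ) :
    ∑ n ∈ Finset.range N, ‖inner ℂ (mono 0 - mulOp b hb ((mulOp b hb).adjoint (mono 0)))
      ((shift.adjoint)^[n] g)‖ ^ 2 ≤ ‖g‖ ^ 2 - ‖(mulOp b hb).adjoint g‖ ^ 2 :=
  sum_norm_inner_sq_le norm_mono_zero adjoint_shift_mono_zero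
    (norm_adjoint_mulOp_le hb h1) (defect_sub_defect_adjoint_shift_nonneg hb h1) g N

/-- Here `(I - M_b M_b^*) 1` is `kernelAtOrigin b`, and pairing it with `S^{*n} g` is pairing `zⁿ`
with `M_k^* g`: the telescoped sum is a Hardy form. -/
lemma hardyForm_adjoint_kernelAtOrigin_le {b : Disc → ℂ} (hb : IsBoundedAnalytic b)
    (h1 : ∀ z, ‖b z‖ ≤ 1) (g : bergmanSpace) :
    hardyForm ((mulOp _ (isBoundedAnalytic_kernelAtOrigin hb)).adjoint g) ≤
      ‖g‖ ^ 2 - ‖(mulOp b hb).adjoint g‖ ^ 2 := by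
  refine le_of_tendsto (hasSum_hardyForm _).tendsto_sum_nat (.of_forall fun N => ?_)
  refine le_trans (Finset.sum_le_sum fun n _ => le_of_eq ?_) (sum_norm_inner_defect_le hb h1 g N)
  rw [inner_iterate_adjoint_shift, iterate_shift_defect_mono_zero,
    ContinuousLinearMap.adjoint_inner_right]

/-- The form of `I - T_z T_z^*` is dominated by that of `I - T_b T_b^*`. -/
lemma exists_hardyForm_le {b : Disc → ℂ} (hb : IsBoundedAnalytic b) (h1 : ∀ z, ‖b z‖ ≤ 1)
    (h0 : ‖b origin‖ < 1) :
    ∃ K : ℝ, ∀ g, hardyForm g ≤ K ^ 2 * (‖g‖ ^ 2 - ‖(mulOp b hb).adjoint g‖ ^ 2) := by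
  have hφ := isBoundedAnalytic_kernelAtOrigin hb
  have hlow : ∀ z, 1 - ‖b origin‖ ≤ ‖kernelAtOrigin b z‖ := fun z => by
    have h2 := norm_sub_norm_le (1 : ℂ) (conj (b origin) * b z)
    rw [norm_one, norm_mul, RCLike.norm_conj] at h2
    have h3 := mul_le_of_le_one_right (norm_nonneg (b origin)) (h1 z)
    exact le_trans (by linarith) h2
  have hpos : 0 < 1 - ‖b origin‖ := by linarith
  have hne : ∀ z, kernelAtOrigin b z ≠ 0 := fun z => norm_pos_iff.1 (hpos.trans_le (hlow z))
  have hbd : ∀ z, ‖(kernelAtOrigin b z)⁻¹‖ ≤ (1 - ‖b origin‖)⁻¹ := fun z => by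
    rw [norm_inv]
    exact inv_anti₀ hpos (hlow z)
  have hψ : IsBoundedAnalytic fun z => (kernelAtOrigin b z)⁻¹ := by
    obtain ⟨F, hF, hbF⟩ := hφ.1
    refine ⟨⟨fun z => (F z)⁻¹, hF.inv fun z hz => ?_, fun z => congrArg _ (hbF z)⟩, _, hbd⟩
    rw [← hbF ⟨z, hz⟩]
    exact hne _
  -- This constant bounds `1/k`, and `M_{1/k}^*` undoes `M_k^*`.
  refine ⟨(1 - ‖b origin‖)⁻¹, fun g => ?_⟩
  have h2 := hardyForm_adjoint_mulOp_le hψ hbd ((mulOp _ hφ).adjoint g)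
  rw [adjoint_mulOp_adjoint_mulOp_of_mul_eq_one hφ hψ fun z => mul_inv_cancel₀ (hne z)] at h2
  exact h2.trans (mul_le_mul_of_nonneg_left (hardyForm_adjoint_kernelAtOrigin_le hb h1 g)
    (sq_nonneg _))

/-- Maximum principle; this is where non-constancy enters. -/
lemma norm_origin_lt_one {b : Disc → ℂ} (hb : b ∈ unitBallHInfty)
    (hconst : ¬ ∃ c : ℂ, ∀ z, b z = c) : ‖b origin‖ < 1 := by
  refine (hb.2 origin).lt_of_ne fun h => hconst ⟨b origin, fun z => ?_⟩
  obtain ⟨F, hF, hbF⟩ := hb.1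
  have hmax : IsMaxOn (norm ∘ F) (ball 0 1) ((origin : Disc) : ℂ) := fun w hw => by
    have := hb.2 ⟨w, hw⟩
    rw [hbF] at this h
    change ‖F w‖ ≤ ‖F (origin : Disc)‖
    rw [h]
    exact this
  have := Complex.eqOn_of_isPreconnected_of_isMaxOn_norm (convex_ball (0 : ℂ) 1).isPreconnected
    isOpen_ball hF origin.2 hmax z.2
  rw [hbF, hbF, this]
  rfl

/-- The Hardy space is contained in the sub-Bergman space. -/
lemma hardySpace_subset {b : Disc → ℂ} (hb : b ∈ unitBallHInfty)
    (hconst : ¬ ∃ c : ℂ, ∀ z, b z = c) :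
    hardySpace ⊆ subBergmanSpace ((memLp_of_mem_unitBallHInfty hb).toLp b) := by
  rintro f ⟨a, ha, hf⟩
  rw [mem_subBergmanSpace_iff hb]
  have hb' := isBoundedAnalytic_of_mem hb
  obtain ⟨K, hK⟩ := exists_hardyForm_le hb' hb.2 (norm_origin_lt_one hb hconst)
  have hsum : ∀ g, Summable fun n => conj (a n) * inner ℂ (mono n) g := fun g => by
    refine .of_norm (.of_nonneg_of_le (fun n => norm_nonneg _) (fun n => ?_)
      (ha.add (hasSum_hardyForm g).summable))
    rw [norm_mul, RCLike.norm_conj]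
    nlinarith [sq_nonneg (‖a n‖ - ‖inner ℂ (mono n) g‖), sq_nonneg ‖a n‖,
      sq_nonneg ‖inner ℂ (mono n) g‖]
  -- This is `g ↦ ⟨f, g⟩` written through the coefficients of `f`. It is bounded by `Q(g)^{1/2}`,
  -- hence by `‖R g‖`, so `l g = ⟨k, R g⟩ = ⟨R k, g⟩` and `f` is represented by `R k`.
  let l : bergmanSpace →ₗ[ℂ] ℂ :=
    { toFun := fun g => ∑' n, conj (a n) * inner ℂ (mono n) g
      map_add' := fun f g => by
        rw [← (hsum f).tsum_add (hsum g)]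
        simp_rw [inner_add_right, mul_add]
      map_smul' := fun c g => by
        rw [RingHom.id_apply, smul_eq_mul, ← tsum_mul_left]
        simp_rw [bergman_inner_smul_right]
        exact tsum_congr fun n => by ring }
  set A := ∑' n, ‖a n‖ ^ 2 with hA
  have hA0 : 0 ≤ A := tsum_nonneg fun n => by positivity
  have hl : ∀ g, ‖l g‖ ≤ (√A * |K|) * ‖defectRoot b hb' g‖ := fun g => by
    have h1 := norm_sq_le_of_hasSum (hsum g).hasSum (D := A) (X := hardyForm g) (fun M => by
      simp_rw [RCLike.norm_conj]
      exact ha.sum_le_tsum _ fun n _ => by positivity) (sum_le_hardyForm g)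
    have h2 := hK g
    rw [← norm_sq_defectRoot hb' hb.2] at h2
    refine le_of_sq_le_sq ?_ (by positivity)
    rw [mul_pow, mul_pow, Real.sq_sqrt hA0, sq_abs, mul_assoc]
    exact h1.trans (mul_le_mul_of_nonneg_left h2 hA0)
  obtain ⟨k, hk⟩ := exists_eq_inner_of_norm_le _ l hl
  refine ⟨k, funext fun z => (hf z).unique ?_⟩
  refine (hasSum_rep (defectRoot b hb' k) z).congr_fun fun n => ?_
  have h1 : inner ℂ (defectRoot b hb' k) (mono n) = conj (a n) / (n + 1) := by
    rw [inner_defectRoot, ← hk]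
    change ∑' m, conj (a m) * inner ℂ (mono m) (mono n) = _
    rw [tsum_eq_single n fun m hm => by rw [inner_mono_mono, if_neg hm, mul_zero],
      inner_mono_mono, if_pos rfl, div_eq_mul_inv]
  have h2 : inner ℂ (mono n) (defectRoot b hb' k) = a n / (n + 1) := by
    rw [← inner_conj_symm (mono n), h1]
    simp
  have h3 : (n : ℂ) + 1 ≠ 0 := by exact_mod_cast n.succ_ne_zero
  rw [h2]
  field_simp

/-! ### Finite Blaschke products: the Hardy form dominates the defect form. -/

/-- The form of `I - T_b T_b^*` is dominated by that of `I - T_z T_z^*`. -/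
def IsDefectBounded (b : Disc → ℂ) : Prop :=
  ∃ (hb : IsBoundedAnalytic b) (K : ℝ), 0 ≤ K ∧
    ∀ g, ‖g‖ ^ 2 - ‖(mulOp b hb).adjoint g‖ ^ 2 ≤ K * hardyForm g

lemma sub_le_of_sub_le_of_sub_le {x y w K L C q r : ℝ} (hL : 0 ≤ L) (h1 : x - y ≤ K * q)
    (h2 : y - w ≤ L * r) (h3 : r ≤ C ^ 2 * q) : x - w ≤ (K + L * C ^ 2) * q := by
  nlinarith [mul_le_mul_of_nonneg_left h3 hL]

/-- The defect is a cocycle: `α_{bc}(g) = α_b(g) + α_c(M_b^* g)`, and `Q(M_b^* g) ≤ C² Q(g)` brings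
the second term back to `g`. -/
lemma IsDefectBounded.mul {b c : Disc → ℂ} (hb : IsDefectBounded b) (hc : IsDefectBounded c) :
    IsDefectBounded (b * c) := by
  obtain ⟨hb, K, hK, h1⟩ := hb
  obtain ⟨hc, L, hL, h2⟩ := hc
  obtain ⟨C, hC⟩ := hb.2
  refine ⟨hb.mul hc, K + L * C ^ 2, by positivity, fun g => ?_⟩
  rw [adjoint_mulOp_mul hb hc]
  exact sub_le_of_sub_le_of_sub_le hL (h1 g) (h2 _) (hardyForm_adjoint_mulOp_le hb hC g)

lemma isBoundedAnalytic_const (c : ℂ) : IsBoundedAnalytic fun _ => c :=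
  ⟨⟨fun _ => c, by fun_prop, fun _ => rfl⟩, ‖c‖, fun _ => le_rfl⟩

lemma adjoint_mulOp_const (c : ℂ) (g : bergmanSpace) :
    (mulOp _ (isBoundedAnalytic_const c)).adjoint g = conj c • g := by
  refine ext_inner_mono fun n => ?_
  rw [ContinuousLinearMap.adjoint_inner_right, bergman_inner_smul_right,
    ← bergman_inner_smul_left]
  congr 1
  exact ext_rep fun z => by rw [rep_mulOp, rep_smul]; rfl

lemma isDefectBounded_const {c : ℂ} (hc : ‖c‖ = 1) : IsDefectBounded fun _ => c := by
  refine ⟨isBoundedAnalytic_const c, 0, le_rfl, fun g => ?_⟩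
  rw [adjoint_mulOp_const, norm_smul, RCLike.norm_conj, hc, one_mul, sub_self, zero_mul]

/-- Vector form of `|1 - āz|² - |z - a|² = (1 - |a|²)(1 - |z|²)`: the real parts of the cross terms
cancel. It serves both with `u = S^* h` and in `ℂ` itself. -/
lemma norm_sub_smul_sq_sub {H : Type*} [NormedAddCommGroup H] [InnerProductSpace ℂ H]
    (h u : H) (a : ℂ) :
    ‖h - a • u‖ ^ 2 - ‖u - conj a • h‖ ^ 2 = (1 - ‖a‖ ^ 2) * (‖h‖ ^ 2 - ‖u‖ ^ 2) := by
  rw [@norm_sub_sq ℂ, @norm_sub_sq ℂ, inner_smul_right, inner_smul_right, norm_smul, norm_smul,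
    RCLike.norm_conj, ← inner_conj_symm u h, ← map_mul, RCLike.conj_re]
  ring

lemma one_sub_conj_mul_ne_zero (a z : Disc) : 1 - conj (a : ℂ) * z ≠ 0 := by
  have ha : ‖(a : ℂ)‖ < 1 := mem_ball_zero_iff.1 a.2
  have hz : ‖(z : ℂ)‖ < 1 := mem_ball_zero_iff.1 z.2
  intro h
  have h1 : ‖conj (a : ℂ) * z‖ = 1 := by rw [← sub_eq_zero.1 h, norm_one]
  rw [norm_mul, RCLike.norm_conj] at h1
  nlinarith [norm_nonneg (a : ℂ), norm_nonneg (z : ℂ)]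

lemma norm_inv_one_sub_conj_mul_le (a z : Disc) :
    ‖(1 - conj (a : ℂ) * z)⁻¹‖ ≤ (1 - ‖(a : ℂ)‖)⁻¹ := by
  have ha : ‖(a : ℂ)‖ < 1 := mem_ball_zero_iff.1 a.2
  have hz : ‖(z : ℂ)‖ < 1 := mem_ball_zero_iff.1 z.2
  rw [norm_inv]
  refine inv_anti₀ (by linarith) ?_
  have h2 := norm_sub_norm_le (1 : ℂ) (conj (a : ℂ) * z)
  rw [norm_one, norm_mul, RCLike.norm_conj] at h2
  nlinarith [norm_nonneg (a : ℂ), norm_nonneg (z : ℂ)]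

lemma isBoundedAnalytic_inv_one_sub (a : Disc) :
    IsBoundedAnalytic fun z : Disc => (1 - conj (a : ℂ) * z)⁻¹ :=
  ⟨⟨fun z => (1 - conj (a : ℂ) * z)⁻¹,
    DifferentiableOn.inv (by fun_prop) fun z hz => one_sub_conj_mul_ne_zero a ⟨z, hz⟩,
    fun _ => rfl⟩, _, norm_inv_one_sub_conj_mul_le a⟩

lemma isBoundedAnalytic_affine (c d : ℂ) : IsBoundedAnalytic fun z : Disc => c + d * z :=
  ⟨⟨fun z => c + d * z, by fun_prop, fun _ => rfl⟩, ‖c‖ + ‖d‖, fun z => by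
    refine (norm_add_le _ _).trans (add_le_add le_rfl ?_)
    rw [norm_mul]
    exact mul_le_of_le_one_right (norm_nonneg _) (mem_ball_zero_iff.1 z.2).le⟩

lemma bergman_inner_add_left (f g h : bergmanSpace) :
    inner ℂ (f + g) h = inner ℂ f h + inner ℂ g h := _root_.inner_add_left f g h

lemma bergman_inner_add_right (f g h : bergmanSpace) :
    inner ℂ f (g + h) = inner ℂ f g + inner ℂ f h := _root_.inner_add_right f g h

lemma adjoint_mulOp_affine (c d : ℂ) (g : bergmanSpace) :
    (mulOp _ (isBoundedAnalytic_affine c d)).adjoint g =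
      conj c • g + conj d • shift.adjoint g := by
  refine ext_inner_mono fun n => ?_
  have h : mulOp _ (isBoundedAnalytic_affine c d) (mono n) = c • mono n + d • shift (mono n) :=
    ext_rep fun z => by
      rw [rep_mulOp, rep_add, rep_smul, rep_smul, shift, rep_mulOp]
      simp only [Pi.mul_apply, Pi.add_apply, Pi.smul_apply, smul_eq_mul]
      ring
  rw [ContinuousLinearMap.adjoint_inner_right, h]
  refine (bergman_inner_add_left _ _ _).trans
    (Eq.trans ?_ (bergman_inner_add_right _ _ _).symm)
  refine congrArg₂ (· + ·) ((bergman_inner_smul_left (mono n) g c).trans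
    (bergman_inner_smul_right (mono n) g (conj c)).symm)
    ((bergman_inner_smul_left (shift (mono n)) g d).trans (Eq.trans ?_
    (bergman_inner_smul_right (mono n) (shift.adjoint g) (conj d)).symm))
  rw [inner_mono_adjoint_shift, shift_mono]

lemma conj_one_smul_add_smul {V : Type*} [AddCommGroup V] [Module ℂ V] (a : ℂ) (h u : V) :
    conj (1 : ℂ) • h + conj (-conj a) • u = h - a • u := by
  simp [sub_eq_add_neg]

lemma conj_neg_smul_add_smul {V : Type*} [AddCommGroup V] [Module ℂ V] (a : ℂ) (h u : V) :
    conj (-a) • h + conj (1 : ℂ) • u = u - conj a • h := by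
  simp [sub_eq_add_neg, add_comm]

lemma defect_moebius (a : Disc) (h : bergmanSpace) :
    ‖(mulOp _ (isBoundedAnalytic_affine 1 (-conj (a : ℂ)))).adjoint h‖ ^ 2 -
      ‖(mulOp _ (isBoundedAnalytic_affine (-(a : ℂ)) 1)).adjoint h‖ ^ 2 =
      (1 - ‖(a : ℂ)‖ ^ 2) * hardyForm h := by
  rw [(adjoint_mulOp_affine 1 (-conj (a : ℂ)) h).trans (conj_one_smul_add_smul _ _ _),
    (adjoint_mulOp_affine (-(a : ℂ)) 1 h).trans (conj_neg_smul_add_smul _ _ _)]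
  exact (norm_sub_smul_sq_sub _ _ _).trans (congrArg _ (norm_sq_adjoint_shift h))

/-- Put `h = M_ψ^* g` with `ψ = 1/(1 - āz)`. Then `g` and `M_φ^* g`, for the Möbius factor `φ`, are
the images of `h` under the adjoints of `1 - āz` and `z - a`, so `defect_moebius` gives `α_φ(g) = (1
- |a|²) Q(h)`; the bound on `ψ` controls `Q(h)`. -/
lemma isDefectBounded_moebius (a : Disc) :
    IsDefectBounded fun z : Disc => ((z : ℂ) - a) / (1 - conj (a : ℂ) * z) := by
  have ha : ‖(a : ℂ)‖ < 1 := mem_ball_zero_iff.1 a.2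
  have hψ := isBoundedAnalytic_inv_one_sub a
  have hz := isBoundedAnalytic_affine (-(a : ℂ)) 1
  have hu := isBoundedAnalytic_affine 1 (-conj (a : ℂ))
  have heq : (fun z : Disc => ((z : ℂ) - a) / (1 - conj (a : ℂ) * z)) =
      (fun z : Disc => (1 - conj (a : ℂ) * z)⁻¹) * fun z : Disc => -(a : ℂ) + 1 * z := by
    funext z
    rw [Pi.mul_apply, div_eq_mul_inv]
    ring
  rw [heq]
  have hnn : 0 ≤ 1 - ‖(a : ℂ)‖ ^ 2 := by nlinarith [norm_nonneg (a : ℂ)]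
  refine ⟨hψ.mul hz, (1 - ‖(a : ℂ)‖ ^ 2) * (1 - ‖(a : ℂ)‖)⁻¹ ^ 2, by positivity, fun g => ?_⟩
  have hg : (mulOp _ hu).adjoint ((mulOp _ hψ).adjoint g) = g :=
    adjoint_mulOp_adjoint_mulOp_of_mul_eq_one hψ hu (fun z => by
      rw [neg_mul, ← sub_eq_add_neg]
      exact inv_mul_cancel₀ (one_sub_conj_mul_ne_zero a z)) g
  have h1 := defect_moebius a ((mulOp _ hψ).adjoint g)
  rw [hg] at h1
  rw [adjoint_mulOp_mul hψ hz, h1, mul_assoc]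
  exact mul_le_mul_of_nonneg_left
    (hardyForm_adjoint_mulOp_le hψ (norm_inv_one_sub_conj_mul_le a) g) hnn

lemma IsFiniteBlaschkeProduct.isDefectBounded {b : Disc → ℂ} (hb : IsFiniteBlaschkeProduct b) :
    IsDefectBounded b := by
  obtain ⟨n, a, c, hc, h⟩ := hb
  have heq : b = (fun _ => c) *
      ∏ k, fun z : Disc => ((z : ℂ) - a k) / (1 - conj (a k : ℂ) * z) := by
    funext z
    rw [h, Pi.mul_apply, Finset.prod_apply]
  rw [heq]
  exact (isDefectBounded_const hc).mul (Finset.prod_induction _ IsDefectBounded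
    (fun _ _ => IsDefectBounded.mul) (isDefectBounded_const norm_one)
    fun k _ => isDefectBounded_moebius (a k))

lemma inner_mono_partialSum (x : ℕ → ℂ) (N n : ℕ) :
    inner ℂ (mono n) (partialSum x N) = if n < N then x n / (n + 1) else 0 := by
  rw [← inner_conj_symm (mono n), inner_partialSum]
  simp_rw [inner_mono_mono]
  split_ifs with h
  · rw [Finset.sum_eq_single n (fun m _ hm => by rw [if_neg hm, mul_zero])
      (fun h' => absurd (Finset.mem_range.2 h) h')]
    simp [div_eq_mul_inv]
  · rw [Finset.sum_eq_zero fun m hm => ?_, map_zero]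
    rw [if_neg (by rintro rfl; exact h (Finset.mem_range.1 hm)), mul_zero]

lemma subBergmanSpace_subset {b : Disc → ℂ} (hb : b ∈ unitBallHInfty) (hd : IsDefectBounded b) :
    subBergmanSpace ((memLp_of_mem_unitBallHInfty hb).toLp b) ⊆ hardySpace := by
  intro f hf
  obtain ⟨h, rfl⟩ := (mem_subBergmanSpace_iff hb).1 hf
  obtain ⟨hb', K, hK, hle⟩ := hd
  set k := defectRoot b hb' h with hk
  set a : ℕ → ℂ := fun n => (n + 1 : ℂ) * inner ℂ (mono n) k with ha
  refine ⟨a, ?_, hasSum_rep k⟩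
  refine summable_of_sum_range_le (c := K * ‖h‖ ^ 2) (fun n => by positivity) fun N => ?_
  set s := ∑ n ∈ Finset.range N, ‖a n‖ ^ 2 with hs
  have hs0 : 0 ≤ s := by positivity
  -- The factor `n + 1` cancels `‖zⁿ‖²`, so both `⟨g, k⟩` and `Q(g)` equal `s`. Then `s = ⟨R g, h⟩ ≤
  -- ‖R g‖ ‖h‖` with `‖R g‖² ≤ K s`, which bounds `s` independently of `N`.
  obtain ⟨g, hg⟩ : ∃ g, g = partialSum (fun n => (n + 1 : ℂ) * a n) N := ⟨_, rfl⟩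
  have hne : ∀ n : ℕ, (n : ℂ) + 1 ≠ 0 := fun n => by exact_mod_cast n.succ_ne_zero
  have h1 : inner ℂ g k = (s : ℂ) := by
    rw [hg, inner_partialSum, hs]
    push_cast
    refine Finset.sum_congr rfl fun n _ => ?_
    have h2 : conj ((n + 1 : ℂ) * a n) = (n + 1) * conj (a n) := by simp
    rw [h2, ← Complex.conj_mul' (a n)]
    simp only [ha]
    ring
  have h2 : hardyForm g = s := by
    refine (hasSum_hardyForm g).unique ?_
    have h3 : ∀ n, ‖inner ℂ (mono n) g‖ ^ 2 = if n < N then ‖a n‖ ^ 2 else 0 := fun n => by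
      rw [hg, inner_mono_partialSum]
      split_ifs
      · rw [mul_div_cancel_left₀ _ (hne n)]
      · simp
    simp_rw [h3]
    have h4 : s = ∑ n ∈ Finset.range N, if n < N then ‖a n‖ ^ 2 else 0 :=
      Finset.sum_congr rfl fun n hn => by rw [if_pos (Finset.mem_range.1 hn)]
    rw [h4]
    exact hasSum_sum_of_ne_finset_zero fun n hn => if_neg (Finset.mem_range.not.1 hn)
  have h3 : s ≤ ‖defectRoot b hb' g‖ * ‖h‖ := by
    have h4 := norm_inner_le_norm (𝕜 := ℂ) (defectRoot b hb' g) h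
    rw [inner_defectRoot, ← hk, h1, Complex.norm_real, Real.norm_of_nonneg hs0] at h4
    exact h4
  have h4 : ‖defectRoot b hb' g‖ ^ 2 ≤ K * s := by
    rw [norm_sq_defectRoot hb' hb.2, ← h2]
    exact hle g
  rcases hs0.eq_or_lt with h0 | h0
  · rw [← h0]
    positivity
  · refine le_of_mul_le_mul_left ?_ h0
    calc s * s ≤ (‖defectRoot b hb' g‖ * ‖h‖) * (‖defectRoot b hb' g‖ * ‖h‖) :=
          mul_le_mul h3 h3 hs0 (by positivity)
      _ = ‖defectRoot b hb' g‖ ^ 2 * ‖h‖ ^ 2 := by ring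
      _ ≤ K * s * ‖h‖ ^ 2 := mul_le_mul_of_nonneg_right h4 (by positivity)
      _ = s * (K * ‖h‖ ^ 2) := by ring

/-! ### From the inclusion in `H²` to a boundary estimate for `b`. -/

/-- The reproducing kernel of the Bergman space. -/
noncomputable def kernel (z : Disc) : bergmanSpace :=
  (InnerProductSpace.toDual ℂ bergmanSpace).symm (ev z)

lemma inner_kernel (z : Disc) (g : bergmanSpace) : inner ℂ (kernel z) g = rep g z :=
  InnerProductSpace.toDual_symm_apply

lemma adjoint_mulOp_kernel {b : Disc → ℂ} (hb : IsBoundedAnalytic b) (z : Disc) :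
    (mulOp b hb).adjoint (kernel z) = conj (b z) • kernel z := by
  refine ext_inner_mono fun n => ?_
  rw [ContinuousLinearMap.adjoint_inner_right, bergman_inner_smul_right,
    ← inner_conj_symm (mulOp b hb (mono n)), ← inner_conj_symm (mono n), inner_kernel,
    inner_kernel, rep_mulOp, Pi.mul_apply, map_mul]

/-- Parseval turns the norm into `∑ (n+1) |z|^{2n}`. -/
lemma norm_sq_kernel (z : Disc) : ‖kernel z‖ ^ 2 = ((1 - ‖(z : ℂ)‖ ^ 2)⁻¹) ^ 2 := by
  have hz : ‖(z : ℂ)‖ < 1 := mem_ball_zero_iff.1 z.2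
  have h1 := hasSum_norm_sq (kernel z)
  have h2 : ∀ n, ‖inner ℂ (mono n) (kernel z)‖ ^ 2 = (‖(z : ℂ)‖ ^ 2) ^ n := fun n => by
    rw [← inner_conj_symm (mono n), inner_kernel, rep_mono, RCLike.norm_conj, norm_pow, ← pow_mul,
      ← pow_mul, mul_comm]
  simp_rw [h2] at h1
  have hr : ‖‖(z : ℂ)‖ ^ 2‖ < 1 := by
    rw [norm_pow, norm_norm]
    exact pow_lt_one₀ (norm_nonneg _) hz two_ne_zero
  have h3 := (hasSum_coe_mul_geometric_of_norm_lt_one hr).add (hasSum_geometric_of_norm_lt_one hr)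
  have h4 : (1 - ‖(z : ℂ)‖ ^ 2) ≠ 0 := by
    rw [norm_pow, norm_norm] at hr
    linarith
  rw [h1.unique (h3.congr_fun fun n => by ring)]
  field_simp
  ring

/-- Cauchy–Schwarz against the geometric series; this growth rate is what separates `H²` from `A²`
below. -/
lemma norm_sq_le_of_mem_hardySpace {f : Disc → ℂ} (hf : f ∈ hardySpace) :
    ∃ A : ℝ, ∀ z : Disc, (1 - ‖(z : ℂ)‖ ^ 2) * ‖f z‖ ^ 2 ≤ A := by
  obtain ⟨a, ha, h⟩ := hf
  refine ⟨∑' n, ‖a n‖ ^ 2, fun z => ?_⟩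
  have hz : ‖(z : ℂ)‖ < 1 := mem_ball_zero_iff.1 z.2
  have hr : ‖(z : ℂ)‖ ^ 2 < 1 := pow_lt_one₀ (norm_nonneg _) hz two_ne_zero
  have h1 := norm_sq_le_of_hasSum (h z) (D := ∑' n, ‖a n‖ ^ 2) (X := (1 - ‖(z : ℂ)‖ ^ 2)⁻¹)
    (fun M => ha.sum_le_tsum _ fun n _ => by positivity) (fun M => by
      refine sum_le_hasSum _ (fun n _ => by positivity)
        ((hasSum_geometric_of_lt_one (sq_nonneg ‖(z : ℂ)‖) hr).congr_fun fun n => ?_)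
      rw [norm_pow, ← pow_mul, ← pow_mul, mul_comm])
  calc (1 - ‖(z : ℂ)‖ ^ 2) * ‖f z‖ ^ 2
      ≤ (1 - ‖(z : ℂ)‖ ^ 2) * ((∑' n, ‖a n‖ ^ 2) * (1 - ‖(z : ℂ)‖ ^ 2)⁻¹) :=
        mul_le_mul_of_nonneg_left h1 (by linarith)
    _ = _ := by
        have : 1 - ‖(z : ℂ)‖ ^ 2 ≠ 0 := by linarith
        field_simp

/-- If the sub-Bergman space is contained in the Hardy space, `1 - |b|²` is dominated by
`1 - |z|²`. -/
lemma exists_one_sub_norm_sq_le {b : Disc → ℂ} (hb : b ∈ unitBallHInfty)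
    (hsub : subBergmanSpace ((memLp_of_mem_unitBallHInfty hb).toLp b) ⊆ hardySpace) :
    ∃ C : ℝ, ∀ z : Disc, 1 - ‖b z‖ ^ 2 ≤ C * (1 - ‖(z : ℂ)‖ ^ 2) := by
  have hb' := isBoundedAnalytic_of_mem hb
  have hpos : ∀ z : Disc, 0 < 1 - ‖(z : ℂ)‖ ^ 2 := fun z => by
    have hz : ‖(z : ℂ)‖ < 1 := mem_ball_zero_iff.1 z.2
    nlinarith [norm_nonneg (z : ℂ)]
  obtain ⟨C, hC⟩ := banach_steinhaus
    -- The growth bound makes these functionals pointwise bounded in `h`, with a bound depending on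
    -- `h`; uniform boundedness makes it a single `C`.
    (g := fun z : Disc => ((√(1 - ‖(z : ℂ)‖ ^ 2) : ℝ) : ℂ) • (ev z ∘L defectRoot b hb'))
    (fun h => by
      obtain ⟨A, hA⟩ := norm_sq_le_of_mem_hardySpace
        (hsub ((mem_subBergmanSpace_iff hb).2 ⟨h, rfl⟩))
      refine ⟨√A, fun z => Real.le_sqrt_of_sq_le ?_⟩
      refine le_trans (le_of_eq ?_) (hA z)
      change ‖((√(1 - ‖(z : ℂ)‖ ^ 2) : ℝ) : ℂ) * rep (defectRoot b hb' h) z‖ ^ 2 = _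
      rw [norm_mul, mul_pow, Complex.norm_real, Real.norm_of_nonneg (Real.sqrt_nonneg _),
        Real.sq_sqrt (hpos z).le])
  refine ⟨C ^ 2, fun z => ?_⟩
  set k := kernel z with hk
  set R := defectRoot b hb' with hR
  -- Testing on `h = R k_z`, the value of `R h` at `z` is `⟨k_z, R R k_z⟩ = ‖R k_z‖²`. Since `M_b^*
  -- k_z = conj(b z) k_z`, this norm is explicit.
  have h1 : √(1 - ‖(z : ℂ)‖ ^ 2) * ‖R k‖ ^ 2 ≤ C * ‖R k‖ := by
    have h2 := ContinuousLinearMap.le_of_opNorm_le _ (hC z) (R k)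
    have h3 : rep (R (R k)) z = ((‖R k‖ ^ 2 : ℝ) : ℂ) := by
      rw [← inner_kernel, ← hk, ← inner_defectRoot, bergman_inner_self]
      push_cast
      rfl
    change ‖((√(1 - ‖(z : ℂ)‖ ^ 2) : ℝ) : ℂ) * rep (R (R k)) z‖ ≤ _ at h2
    rw [h3, norm_mul, Complex.norm_real, Complex.norm_real, Real.norm_of_nonneg (by positivity),
      Real.norm_of_nonneg (by positivity)] at h2
    exact h2
  have h2 : ‖R k‖ ^ 2 = (1 - ‖b z‖ ^ 2) * ((1 - ‖(z : ℂ)‖ ^ 2)⁻¹) ^ 2 := by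
    rw [norm_sq_defectRoot hb' hb.2, adjoint_mulOp_kernel, norm_smul, RCLike.norm_conj, mul_pow,
      ← norm_sq_kernel, ← hk]
    ring
  have h3 : (1 - ‖(z : ℂ)‖ ^ 2) * ‖R k‖ ^ 2 ≤ C ^ 2 := by
    rcases (norm_nonneg (R k)).eq_or_lt with h0 | h0
    · rw [← h0]
      simpa using sq_nonneg C
    · have h4 : √(1 - ‖(z : ℂ)‖ ^ 2) * ‖R k‖ ≤ C := by
        refine le_of_mul_le_mul_right ?_ h0
        rwa [mul_assoc, ← sq]
      have h5 := pow_le_pow_left₀ (by positivity) h4 2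
      rwa [mul_pow, Real.sq_sqrt (hpos z).le] at h5
  have h4 := (hpos z).ne'
  rw [h2] at h3
  calc 1 - ‖b z‖ ^ 2 = ((1 - ‖(z : ℂ)‖ ^ 2) * ((1 - ‖b z‖ ^ 2) * ((1 - ‖(z : ℂ)‖ ^ 2)⁻¹) ^ 2)) *
        (1 - ‖(z : ℂ)‖ ^ 2) := by field_simp
    _ ≤ C ^ 2 * (1 - ‖(z : ℂ)‖ ^ 2) := mul_le_mul_of_nonneg_right h3 (hpos z).le

/-! ### Analytic functions of unimodular boundary modulus. -/

/-- The filter of approach to the unit circle from inside the disc. -/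
noncomputable def boundary : Filter ℂ := comap norm (𝓝[<] 1)

lemma exists_of_eventually_boundary {p : ℂ → Prop} (h : ∀ᶠ z in boundary, p z) :
    ∃ ρ : ℝ, 0 ≤ ρ ∧ ρ < 1 ∧ ∀ z, ρ < ‖z‖ → ‖z‖ < 1 → p z := by
  rw [boundary, eventually_comap] at h
  obtain ⟨l, hl, hp⟩ := (mem_nhdsLT_iff_exists_Ioo_subset' (zero_lt_one' ℝ)).1 h
  exact ⟨max l 0, le_max_right _ _, max_lt hl one_pos,
    fun z h1 h2 => hp ⟨(le_max_left _ _).trans_lt h1, h2⟩ z rfl⟩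

lemma eventually_boundary_mem_ball : ∀ᶠ z in boundary, z ∈ ball (0 : ℂ) 1 :=
  (eventually_comap.2 (eventually_nhdsWithin_of_forall fun _ hr _ hz =>
    mem_ball_zero_iff.2 (hz ▸ hr)))

lemma tendsto_norm_boundary : Tendsto norm boundary (𝓝 (1 : ℝ)) :=
  tendsto_comap.mono_right nhdsWithin_le_nhds

/-- Nothing is known on the unit circle, so the maximum principle is applied on a circle of radius
`R < 1` on which `‖F‖ ≤ 1 + ε`. -/
lemma norm_le_one_of_tendsto_boundary {F : ℂ → ℂ} (hF : DifferentiableOn ℂ F (ball 0 1))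
    (h : Tendsto (fun z => ‖F z‖) boundary (𝓝 1)) {z : ℂ} (hz : z ∈ ball (0 : ℂ) 1) :
    ‖F z‖ ≤ 1 := by
  refine le_of_forall_pos_le_add fun ε hε => ?_
  obtain ⟨ρ, hρ0, hρ, hb⟩ := exists_of_eventually_boundary
    (h.eventually_le_const (by linarith : (1 : ℝ) < 1 + ε))
  rw [mem_ball_zero_iff] at hz
  obtain ⟨R, hR, hR1⟩ := exists_between (max_lt hρ hz)
  have hR0 : 0 < R := hρ0.trans_lt ((le_max_left _ _).trans_lt hR)
  have hd : DiffContOnCl ℂ F (ball 0 R) := DifferentiableOn.diffContOnCl (by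
    rw [closure_ball (0 : ℂ) hR0.ne']
    exact hF.mono (closedBall_subset_ball hR1))
  refine Complex.norm_le_of_forall_mem_frontier_norm_le isBounded_ball hd (fun w hw => ?_)
    (subset_closure (mem_ball_zero_iff.2 ((le_max_right _ _).trans_lt hR)))
  rw [frontier_ball (0 : ℂ) hR0.ne', mem_sphere_zero_iff_norm] at hw
  exact hb w (hw ▸ (le_max_left _ _).trans_lt hR) (hw ▸ hR1)

lemma tendsto_boundary_of_one_sub_le {F : ℂ → ℂ} {C : ℝ} (h1 : ∀ z ∈ ball (0 : ℂ) 1, ‖F z‖ ≤ 1)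
    (hC : ∀ z ∈ ball (0 : ℂ) 1, 1 - ‖F z‖ ^ 2 ≤ C * (1 - ‖z‖ ^ 2)) :
    Tendsto (fun z => ‖F z‖) boundary (𝓝 1) := by
  have hlim : Tendsto (fun z : ℂ => 1 - C * (1 - ‖z‖ ^ 2)) boundary (𝓝 1) := by
    simpa using (((tendsto_norm_boundary.pow 2).const_sub 1).const_mul C).const_sub 1
  refine tendsto_of_tendsto_of_tendsto_of_le_of_le' hlim tendsto_const_nhds ?_
    (eventually_boundary_mem_ball.mono h1)
  filter_upwards [eventually_boundary_mem_ball] with z hz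
  nlinarith [h1 z hz, hC z hz, norm_nonneg (F z)]

lemma norm_sq_one_sub_sub_norm_sq (a z : ℂ) :
    ‖1 - conj a * z‖ ^ 2 - ‖z - a‖ ^ 2 = (1 - ‖a‖ ^ 2) * (1 - ‖z‖ ^ 2) := by
  simpa using norm_sub_smul_sq_sub (1 : ℂ) z (conj a)

/-- The disc automorphism vanishing at `a`. -/
noncomputable def moebius (a z : ℂ) : ℂ := (z - a) / (1 - conj a * z)

lemma one_sub_norm_sq_moebius (a z : Disc) :
    1 - ‖moebius a z‖ ^ 2 =
      (1 - ‖(a : ℂ)‖ ^ 2) * (1 - ‖(z : ℂ)‖ ^ 2) / ‖1 - conj (a : ℂ) * z‖ ^ 2 := by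
  have h := norm_ne_zero_iff.2 (one_sub_conj_mul_ne_zero a z)
  rw [← norm_sq_one_sub_sub_norm_sq, moebius, norm_div, div_pow, sub_div,
    div_self (pow_ne_zero 2 h)]

lemma one_sub_norm_sq_pos (z : Disc) : 0 < 1 - ‖(z : ℂ)‖ ^ 2 := by
  have hz : ‖(z : ℂ)‖ < 1 := mem_ball_zero_iff.1 z.2
  nlinarith [norm_nonneg (z : ℂ)]

lemma norm_moebius_le_one (a z : Disc) : ‖moebius a z‖ ≤ 1 := by
  have h := one_sub_norm_sq_moebius a z
  have h2 : 0 ≤ (1 - ‖(a : ℂ)‖ ^ 2) * (1 - ‖(z : ℂ)‖ ^ 2) / ‖1 - conj (a : ℂ) * z‖ ^ 2 :=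
    div_nonneg (mul_nonneg (one_sub_norm_sq_pos a).le (one_sub_norm_sq_pos z).le) (sq_nonneg _)
  nlinarith [norm_nonneg (moebius a z)]

lemma tendsto_norm_moebius_boundary (a : Disc) :
    Tendsto (fun z => ‖moebius a z‖) boundary (𝓝 1) := by
  refine tendsto_boundary_of_one_sub_le (C := (1 - ‖(a : ℂ)‖ ^ 2) * (1 - ‖(a : ℂ)‖)⁻¹ ^ 2)
    (fun z hz => norm_moebius_le_one a ⟨z, hz⟩) fun z hz => ?_
  have h := one_sub_norm_sq_moebius a ⟨z, hz⟩
  have h2 := norm_inv_one_sub_conj_mul_le a ⟨z, hz⟩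
  have h3 := pow_le_pow_left₀ (norm_nonneg _) h2 2
  rw [norm_inv, inv_pow] at h3
  change 1 - ‖moebius a z‖ ^ 2 = _ at h
  rw [h, div_eq_mul_inv, mul_right_comm]
  exact mul_le_mul_of_nonneg_right (mul_le_mul_of_nonneg_left h3 (one_sub_norm_sq_pos a).le)
    (one_sub_norm_sq_pos ⟨z, hz⟩).le

lemma IsFiniteBlaschkeProduct.moebius_mul {b : Disc → ℂ} (hb : IsFiniteBlaschkeProduct b)
    (a : Disc) : IsFiniteBlaschkeProduct fun z => moebius a z * b z := by
  obtain ⟨n, s, c, hc, h⟩ := hb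
  refine ⟨n + 1, Fin.cons a s, c, hc, fun z => ?_⟩
  rw [Fin.prod_univ_succ]
  simp only [h, moebius, Fin.cons_zero, Fin.cons_succ]
  ring

/-- The maximum principle applies to `F` and to `1/F`, so `|F| = 1` throughout and `F` is constant:
a product with no factors. -/
lemma isFiniteBlaschkeProduct_of_ne_zero {F : ℂ → ℂ} (hF : DifferentiableOn ℂ F (ball 0 1))
    (h : Tendsto (fun z => ‖F z‖) boundary (𝓝 1)) (h0 : ∀ z ∈ ball (0 : ℂ) 1, F z ≠ 0) :
    IsFiniteBlaschkeProduct fun z : Disc => F z := by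
  have h1 : ∀ z ∈ ball (0 : ℂ) 1, ‖F z‖ = 1 := by
    intro z hz
    refine le_antisymm (norm_le_one_of_tendsto_boundary hF h hz) ?_
    have hinv : Tendsto (fun z => ‖(F z)⁻¹‖) boundary (𝓝 1) := by
      simpa using h.inv₀ one_ne_zero
    have := norm_le_one_of_tendsto_boundary (hF.inv h0) hinv hz
    rw [Pi.inv_apply, norm_inv] at this
    exact (inv_le_one₀ (norm_pos_iff.2 (h0 z hz))).1 this
  have h00 : (0 : ℂ) ∈ ball (0 : ℂ) 1 := by simp
  refine ⟨0, Fin.elim0, F 0, h1 0 h00, fun z => ?_⟩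
  have hmax : IsMaxOn (norm ∘ F) (ball 0 1) 0 := fun w hw => by
    change ‖F w‖ ≤ ‖F 0‖
    rw [h1 w hw, h1 0 h00]
  simpa using Complex.eqOn_of_isPreconnected_of_isMaxOn_norm
    (convex_ball (0 : ℂ) 1).isPreconnected isOpen_ball hF h00 hmax z.2

/-- A zero of a function of unimodular boundary values can be divided out. -/
lemma exists_eq_moebius_mul {F : ℂ → ℂ} (hF : DifferentiableOn ℂ F (ball 0 1))
    (h : Tendsto (fun z => ‖F z‖) boundary (𝓝 1)) (a : Disc) (ha : F a = 0) :
    ∃ G : ℂ → ℂ, DifferentiableOn ℂ G (ball 0 1) ∧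
      Tendsto (fun z => ‖G z‖) boundary (𝓝 1) ∧
      ∀ z ∈ ball (0 : ℂ) 1, F z = moebius a z * G z := by
  have heq : ∀ z ∈ ball (0 : ℂ) 1,
      F z = moebius a z * (dslope F a z * (1 - conj (a : ℂ) * z)) := by
    intro z hz
    have h1 := sub_smul_dslope F (a : ℂ) z
    -- `dslope F a` is the quotient `F z / (z - a)` with the removable singularity at `a` filled in.
    rw [ha, sub_zero, smul_eq_mul] at h1
    have h2 := one_sub_conj_mul_ne_zero a ⟨z, hz⟩
    change 1 - conj (a : ℂ) * z ≠ 0 at h2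
    rw [moebius, ← h1, mul_comm (dslope F a z), ← mul_assoc, div_mul_cancel₀ _ h2]
  refine ⟨fun z => dslope F a z * (1 - conj (a : ℂ) * z),
    ((Complex.differentiableOn_dslope (isOpen_ball.mem_nhds a.2)).2 hF).mul (by fun_prop), ?_, heq⟩
  have hφ := tendsto_norm_moebius_boundary a
  have hlim := h.div hφ one_ne_zero
  rw [div_one] at hlim
  refine hlim.congr' ?_
  filter_upwards [eventually_boundary_mem_ball, hφ.eventually_const_lt zero_lt_one] with z hz h0
  rw [Pi.div_apply, heq z hz, norm_mul, mul_div_cancel_left₀ _ h0.ne']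

/-- Here `n` limits the number of divisions. Removing a zero multiplies `‖F z₀‖²` by at least `1/κ`,
while the maximum principle keeps it at most `1`; at `n = 0` the hypothesis would read `1 < ‖F
z₀‖²`. Multiplicities thus need no separate count. -/
lemma isFiniteBlaschkeProduct_of_pow_lt {ρ κ : ℝ} {z₀ : Disc} (hκ : 0 < κ)
    (hle : ∀ a : Disc, ‖(a : ℂ)‖ ≤ ρ → ‖moebius a z₀‖ ^ 2 ≤ κ) (n : ℕ) {F : ℂ → ℂ}
    (hF : DifferentiableOn ℂ F (ball 0 1)) (h : Tendsto (fun z => ‖F z‖) boundary (𝓝 1))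
    (hzero : ∀ z ∈ ball (0 : ℂ) 1, F z = 0 → ‖z‖ ≤ ρ) (hn : κ ^ n < ‖F z₀‖ ^ 2) :
    IsFiniteBlaschkeProduct fun z : Disc => F z := by
  induction n generalizing F with
  | zero =>
    have := pow_le_one₀ (norm_nonneg _) (norm_le_one_of_tendsto_boundary hF h z₀.2) (n := 2)
    rw [pow_zero] at hn
    exact absurd hn this.not_gt
  | succ n ih =>
    by_cases h0 : ∀ z ∈ ball (0 : ℂ) 1, F z ≠ 0
    · exact isFiniteBlaschkeProduct_of_ne_zero hF h h0
    push Not at h0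
    obtain ⟨a, ha, hFa⟩ := h0
    obtain ⟨G, hG, hGlim, hFG⟩ := exists_eq_moebius_mul hF h ⟨a, ha⟩ hFa
    have key := ih hG hGlim (fun z hz hGz => hzero z hz (by rw [hFG z hz, hGz, mul_zero])) (by
      rw [hFG z₀ z₀.2, norm_mul, mul_pow, pow_succ'] at hn
      exact lt_of_mul_lt_mul_left (hn.trans_le (mul_le_mul_of_nonneg_right
        (hle ⟨a, ha⟩ (hzero a ha hFa)) (sq_nonneg _))) hκ.le)
    have heq : (fun z : Disc => F z) = fun z : Disc => moebius (⟨a, ha⟩ : Disc) z * G z :=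
      funext fun z => hFG z z.2
    rw [heq]
    exact key.moebius_mul _

/-- An analytic function whose modulus tends to one at the boundary is a finite Blaschke product. -/
lemma isFiniteBlaschkeProduct_of_tendsto {F : ℂ → ℂ} (hF : DifferentiableOn ℂ F (ball 0 1))
    (h : Tendsto (fun z => ‖F z‖) boundary (𝓝 1)) :
    IsFiniteBlaschkeProduct fun z : Disc => F z := by
  obtain ⟨ρ, hρ0, hρ, hne⟩ := exists_of_eventually_boundary (h.eventually_const_lt zero_lt_one)
  obtain ⟨r, hr, hr1⟩ := exists_between hρ
  -- The zeros of `F` have modulus at most `ρ`; the base point `r` lies outside that disc, so `F`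
  -- does not vanish there.
  have hr0 : ‖(r : ℂ)‖ = r := by
    rw [Complex.norm_real, Real.norm_of_nonneg (hρ0.trans hr.le)]
  set z₀ : Disc := ⟨r, by rw [mem_ball_zero_iff, hr0]; exact hr1⟩ with hz₀
  have hF0 : 0 < ‖F z₀‖ := hne r (hr0.symm ▸ hr) (hr0.symm ▸ hr1)
  have hz₀pos := one_sub_norm_sq_pos z₀
  have hρ2 : 0 < 1 - ρ ^ 2 := by nlinarith
  -- Lower bound for `1 - ‖moebius a z₀‖²` when `‖a‖ ≤ ρ`, from `one_sub_norm_sq_moebius` with the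
  -- denominator `‖1 - āz₀‖²` at most `4`.
  set δ : ℝ := (1 - ρ ^ 2) * (1 - ‖(z₀ : ℂ)‖ ^ 2) / 4 with hδ
  have hδ0 : 0 < δ := by positivity
  have hδ1 : δ < 1 := by nlinarith [sq_nonneg ρ, sq_nonneg ‖(z₀ : ℂ)‖]
  have hle : ∀ a : Disc, ‖(a : ℂ)‖ ≤ ρ → ‖moebius a z₀‖ ^ 2 ≤ 1 - δ := by
    intro a ha
    have h1 := one_sub_norm_sq_moebius a z₀
    have h2 : ‖1 - conj (a : ℂ) * z₀‖ ^ 2 ≤ 4 := by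
      have h3 := norm_sub_le (1 : ℂ) (conj (a : ℂ) * z₀)
      rw [norm_one, norm_mul, RCLike.norm_conj] at h3
      have ha1 : ‖(a : ℂ)‖ < 1 := mem_ball_zero_iff.1 a.2
      have hz1 : ‖(z₀ : ℂ)‖ < 1 := mem_ball_zero_iff.1 z₀.2
      have h4 : ‖(a : ℂ)‖ * ‖(z₀ : ℂ)‖ ≤ 1 := mul_le_one₀ ha1.le (norm_nonneg _) hz1.le
      nlinarith [norm_nonneg (1 - conj (a : ℂ) * z₀)]
    have h3 : δ ≤ (1 - ‖(a : ℂ)‖ ^ 2) * (1 - ‖(z₀ : ℂ)‖ ^ 2) / ‖1 - conj (a : ℂ) * z₀‖ ^ 2 := by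
      refine div_le_div₀ (mul_nonneg (one_sub_norm_sq_pos a).le hz₀pos.le) ?_
        (pow_pos (norm_pos_iff.2 (one_sub_conj_mul_ne_zero a z₀)) 2) h2
      exact mul_le_mul_of_nonneg_right
        (sub_le_sub_left (pow_le_pow_left₀ (norm_nonneg _) ha 2) 1) hz₀pos.le
    linarith
  obtain ⟨n, hn⟩ := exists_pow_lt_of_lt_one (pow_pos hF0 2) (by linarith : 1 - δ < 1)
  refine isFiniteBlaschkeProduct_of_pow_lt (by linarith) hle n hF h (fun z hz hz0 => ?_) hn
  by_contra hlt
  have := hne z (not_le.1 hlt) (mem_ball_zero_iff.1 hz)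
  rw [hz0, norm_zero] at this
  exact lt_irrefl _ this

end SubBergman

theorem theorem2 (b : SubBergman.Disc → ℂ) (hb : b ∈ SubBergman.unitBallHInfty)
    (hconst : ¬ ∃ c : ℂ, ∀ z, b z = c) :
    SubBergman.hardySpace ⊆
        SubBergman.subBergmanSpace ((SubBergman.memLp_of_mem_unitBallHInfty hb).toLp b) ∧
      (SubBergman.subBergmanSpace ((SubBergman.memLp_of_mem_unitBallHInfty hb).toLp b) =
          SubBergman.hardySpace ↔
        SubBergman.IsFiniteBlaschkeProduct b) := by
  have hsub := SubBergman.hardySpace_subset hb hconst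
  refine ⟨hsub, fun h => ?_, fun h =>
    (SubBergman.subBergmanSpace_subset hb h.isDefectBounded).antisymm hsub⟩
  obtain ⟨C, hC⟩ := SubBergman.exists_one_sub_norm_sq_le hb h.subset
  obtain ⟨F, hF, hbF⟩ := hb.1
  have heq : b = fun z : SubBergman.Disc => F z := funext hbF
  rw [heq]
  refine SubBergman.isFiniteBlaschkeProduct_of_tendsto hF
    (SubBergman.tendsto_boundary_of_one_sub_le (C := C) (fun z hz => ?_) fun z hz => ?_)
  · rw [← hbF ⟨z, hz⟩]
    exact hb.2 _
  · rw [← hbF ⟨z, hz⟩]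
    exact hC ⟨z, hz⟩
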